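/- \textbf{Setting.} A finite-horizon layered POMDP $\mathcal P=(H,\mathcal X,\mathcal S,\mathcal A,\mathbb P,\mathbb O,R)$ has, for each step $h\in\{1,\dots,H\}$, finite sets $\mathcal S_h$ (latent states), $\mathcal X_h$ (observations), $\mathcal A_h\neq\emptyset$ (actions), an initial law $\mathbb P_1\in\Delta(\mathcal S_1)$, transitions $\mathbb P_h:\mathcal S_{h-1}\times\mathcal A_{h-1}\to\Delta(\mathcal S_h)$ ($h\ge 2$), emissions $\mathbb O_h:\mathcal S_h\to\Delta(\mathcal X_h)$ and rewards $R_h:\mathcal S_h\times\mathcal A_h\to[0,1]$; we assume $\sum_{h}R_h(s_h,a_h)\le 1$ almost surely under every policy. Let $S:=\max_{h}|\mathcal S_h|$. For a policy $\pi$, let $\mathbb P^\pi$ be the law of the trajectory $(s_h,x_h,a_h)_{h=1}^H$ generated by $s_1\sim\mathbb P_1$, $s_h\sim\mathbb P_h(s_{h-1},a_{h-1})$, $x_h\sim\mathbb O_h(s_h)$, $a_h\sim\pi_h$, let $\mathbb P^\pi_{\mathrm{lat}}$ be its marginal law of the latent trajectory $(s_h,a_h)_{h=1}^H$, and let $J(\pi):=\mathbb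 E^\pi[\sum_h R_h(s_h,a_h)]$. A latent policy is a collection $\pi^{\mathrm{lat}}_h:\mathcal S_h\to\Delta(\mathcal A_h)$. For $L\in\mathbb N$, an $L$-step executable policy is a collection of maps $\pi_h$ from windows $(x_{\max(1,h-L+1):h},a_{\max(1,h-L):h-1})$ to $\Delta(\mathcal A_h)$; let $\Pi^L_h$ be the set of all such maps at step $h$. An executable policy is an $H$-step executable policy. $\mathsf{TV}$ denotes total variation distance. The POMDP is a \emph{$\delta$-perturbed Block MDP} ($\delta>0$) if for each $h\in\{1,\dots,H\}$ there are $\widetilde{\mathbb O}_h,E_h:\mathcal S_h\to\Delta(\mathcal X_h)$ such that $\widetilde{\mathbb O}_h(\cdot\mid s)$, $\widetilde{\mathbb O}_h(\cdot\mid s')$ have disjoint supports for all $s\ne s'$ and $\mathbb O_h=(1-\delta)\widetilde{\mathbb O}_h+\delta E_h$. It has \emph{deterministic transitions} if for all $h\ge 2$, $s$ and $a$, the law $\mathbb P_h(s,a)$ is a point mass (the initial state may be random). An $L$-step executable policy $\widetilde\pi$ is an output of $\mathtt{Forward}$ with $L$-step random actions and expert $\pi^{\mathrm{lat}}$, in the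 infinite-sample limit, if for every $h\in\{1,\dots,H\}$ \[\widetilde\pi_h\in\arg\max_{\pi_h\in\Pi^L_h}\ \mathbb E\big[\log \pi_h\big(a'\mid x_{\max(1,h-L+1):h},a_{\max(1,h-L):h-1}\big)\big],\] where $\log 0=-\infty$, the trajectory is drawn by following $\widetilde\pi$ at the steps $i<h-L$ and playing uniformly random actions at the steps $i\ge h-L$, and $a'\sim\pi^{\mathrm{lat}}_h(s_h)$. \textbf{Theorem.} There are universal constants $C_1>0$ and $C>1$ such that the following holds. Let $\mathcal P$ be a $\delta$-perturbed Block MDP with deterministic transitions, let $L\in\mathbb N$, let $\pi^{\mathrm{lat}}$ be any latent policy, and let $\widetilde\pi$ be any output of $\mathtt{Forward}$ with $L$-step random actions and expert $\pi^{\mathrm{lat}}$ in the infinite-sample limit. Then \[J(\pi^{\mathrm{lat}})-J(\widetilde\pi)\ \le\ \mathsf{TV}\big(\mathbb P^{\pi^{\mathrm{lat}}}_{\mathrm{lat}},\mathbb P^{\widetilde\pi}_{\mathrm{lat}}\big)\ \le\ \mathsf{TV}\big(\mathbb P^{\pi^{\mathrm{lat}}},\mathbb P^{\widetilde\pi}\big)\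 \le\ C_1\delta+(C\delta)^{L/9}\,S\,H.\] If moreover $\pi^{\mathrm{lat}}$ maximizes $J$ among latent policies and $\pi^\star$ maximizes $J$ among executable policies, then $J(\pi^\star)-J(\widetilde\pi)\le J(\pi^{\mathrm{lat}})-J(\widetilde\pi)$, so the same bound holds for $J(\pi^\star)-J(\widetilde\pi)$. -/

import Mathlib

noncomputable section

/-- `PDist α` is the set `Δ(α)` of probability distributions on a finite set `α`. -/
abbrev PDist (α : Type*) [Fintype α] : Type _ := stdSimplex ℝ α

/-- The uniform distribution on a nonempty finite set. -/
def uniformDist (α : Type*) [Fintype α] [Nonempty α] : PDist α :=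
  ⟨fun _ => (Fintype.card α : ℝ)⁻¹, fun _ => by positivity, by
    simp [Finset.sum_const, Finset.card_univ]⟩

/-- Total variation distance between two distributions, given by their mass functions. -/
def tvDist {α : Type*} [Fintype α] (p q : α → ℝ) : ℝ :=
  (1 / 2) * ∑ a, |p a - q a|

/-- A finite-horizon, layered POMDP. Steps are numbered from `0`, so step `h` of the code is step
`h + 1` in the usual numbering, and the process consists of the steps `h < horizon`. The data of
the layers `h ≥ horizon` plays no role anywhere. -/
structure POMDP (S X A : ℕ → Type*)
    [∀ h, Fintype (S h)] [∀ h, Fintype (X h)] [∀ h, Fintype (A h)] where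
  /-- the horizon `H` -/
  horizon : ℕ
  /-- the law of the initial latent state -/
  init : PDist (S 0)
  /-- the latent transitions -/
  trans : ∀ h, S h → A h → PDist (S (h + 1))
  /-- the emission distributions -/
  emit : ∀ h, S h → PDist (X h)
  /-- the rewards -/
  reward : ∀ h, S h → A h → ℝ
  reward_mem : ∀ h s a, reward h s a ∈ Set.Icc (0 : ℝ) 1

/-- Trajectories `(s, x, a)` of the first `n` steps. Rewards are a function of states and actions
and are not recorded. -/
abbrev Traj (S X A : ℕ → Type*) (n : ℕ) : Type _ :=
  (∀ i : Fin n, S i) × (∀ i : Fin n, X i) × (∀ i : Fin n, A i)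

/-- Arbitrary (not necessarily executable) randomized policies: the action at step `h` may depend
on all states and observations up to and including step `h` and on all previous actions. -/
abbrev Policy (S X A : ℕ → Type*) [∀ h, Fintype (A h)] : Type _ :=
  ∀ h : ℕ, (∀ i : Fin (h + 1), S i) → (∀ i : Fin (h + 1), X i) → (∀ i : Fin h, A i) → PDist (A h)

/-- Latent (Markovian) policies. -/
abbrev LatentPolicy (S A : ℕ → Type*) [∀ h, Fintype (A h)] : Type _ :=
  ∀ h : ℕ, S h → PDist (A h)

/-- The observations `x_i` with `max(0, h - L + 1) ≤ i ≤ h`. -/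
abbrev ObsWindow (X : ℕ → Type*) (L h : ℕ) : Type _ :=
  ∀ i : {i : ℕ // i ≤ h ∧ h < i + L}, X i

/-- The actions `a_i` with `max(0, h - L) ≤ i < h`. -/
abbrev ActWindow (A : ℕ → Type*) (L h : ℕ) : Type _ :=
  ∀ i : {i : ℕ // i < h ∧ h ≤ i + L}, A i

/-- `L`-step decision rules at step `h`. -/
abbrev LStepRule (X A : ℕ → Type*) [∀ h, Fintype (A h)] (L h : ℕ) : Type _ :=
  ObsWindow X L h → ActWindow A L h → PDist (A h)

/-- `L`-step executable policies. -/
abbrev LStepPolicy (X A : ℕ → Type*) [∀ h, Fintype (A h)] (L : ℕ) : Type _ :=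
  ∀ h : ℕ, LStepRule X A L h

/-- Restriction of an observation history to the last `L` observations. -/
def obsWindow {X : ℕ → Type*} (L h : ℕ) (x : ∀ i : Fin (h + 1), X i) : ObsWindow X L h :=
  fun i => x ⟨i.1, Nat.lt_succ_of_le i.2.1⟩

/-- Restriction of an action history to the last `L` actions. -/
def actWindow {A : ℕ → Type*} (L h : ℕ) (a : ∀ i : Fin h, A i) : ActWindow A L h :=
  fun i => a ⟨i.1, i.2.1⟩

section Policies

variable {S X A : ℕ → Type*} [∀ h, Fintype (A h)]

/-- A latent policy, as a policy. -/
def LatentPolicy.toPolicy (πlat : LatentPolicy S A) : Policy S X A :=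
  fun h s _ _ => πlat h (s (Fin.last h))

/-- An `L`-step executable policy, as a policy. -/
def LStepPolicy.toPolicy {L : ℕ} (π : LStepPolicy X A L) : Policy S X A :=
  fun h _ x a => π h (obsWindow L h x) (actWindow L h a)

/-- The policy that follows `π` at the steps `h < t - L` and afterwards plays uniformly random
actions. -/
def rollIn [∀ h, Nonempty (A h)] {L : ℕ} (π : LStepPolicy X A L) (t : ℕ) : Policy S X A :=
  fun h s x a =>
    if h + L < t then LStepPolicy.toPolicy π h s x a else uniformDist (A h)

end Policies

namespace POMDP

variable {S X A : ℕ → Type*}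
  [∀ h, Fintype (S h)] [∀ h, Fintype (X h)] [∀ h, Fintype (A h)]

/-- The conditional law of the next latent state, given the states and actions so far. -/
def nextState (P : POMDP S X A) : ∀ n : ℕ, (∀ i : Fin n, S i) → (∀ i : Fin n, A i) → PDist (S n)
  | 0, _, _ => P.init
  | n + 1, s, a => P.trans n (s (Fin.last n)) (a (Fin.last n))

/-- The law (mass function) of the first `n` steps of the trajectory under the policy `π`: at each
step the latent state, the observation and the action are drawn in turn. -/
def law (P : POMDP S X A) (π : Policy S X A) : ∀ n : ℕ, Traj S X A n → ℝ
  | 0, _ => 1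
  | n + 1, (s, x, a) =>
      P.law π n (fun i => s i.castSucc, fun i => x i.castSucc, fun i => a i.castSucc)
        * P.nextState n (fun i => s i.castSucc) (fun i => a i.castSucc) (s (Fin.last n))
        * P.emit n (s (Fin.last n)) (x (Fin.last n))
        * π n s x (fun i => a i.castSucc) (a (Fin.last n))

/-- The law of the full trajectory. -/
def trajLaw (P : POMDP S X A) (π : Policy S X A) : Traj S X A P.horizon → ℝ :=
  P.law π P.horizon

/-- The law of the latent trajectory `(s, a)`. -/
def latentLaw (P : POMDP S X A) (π : Policy S X A) :
    (∀ i : Fin P.horizon, S i) × (∀ i : Fin P.horizon, A i) → ℝ :=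
  fun τ => ∑ x : ∀ i : Fin P.horizon, X i, P.trajLaw π (τ.1, x, τ.2)

/-- The total reward collected along a trajectory. -/
def totalReward (P : POMDP S X A) (τ : Traj S X A P.horizon) : ℝ :=
  ∑ i : Fin P.horizon, P.reward i (τ.1 i) (τ.2.2 i)

/-- The value `J(π)`. -/
def value (P : POMDP S X A) (π : Policy S X A) : ℝ :=
  ∑ τ, P.trajLaw π τ * P.totalReward τ

/-- The total reward is at most `1` almost surely under all policies. -/
def RewardsAtMostOne (P : POMDP S X A) : Prop :=
  ∀ (π : Policy S X A) (τ : Traj S X A P.horizon), P.trajLaw π τ ≠ 0 → P.totalReward τ ≤ 1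

/-- Latent transitions are deterministic (the initial state may be random). -/
def DeterministicTransitions (P : POMDP S X A) : Prop :=
  ∀ h, h + 1 < P.horizon → ∀ (s : S h) (a : A h), ∃ s' : S (h + 1), P.trans h s a s' = 1

/-- `P` is a `δ`-perturbed Block MDP. -/
def IsPerturbedBlockMDP (P : POMDP S X A) (δ : ℝ) : Prop :=
  0 < δ ∧ ∀ h, h < P.horizon → ∃ O' E : S h → PDist (X h),
    (∀ s s' : S h, s ≠ s' →
      Disjoint (Function.support (O' s : X h → ℝ)) (Function.support (O' s' : X h → ℝ))) ∧
    ∀ (s : S h) (x : X h), P.emit h s x = (1 - δ) * O' s x + δ * E s x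

/-- `S = max_h |S_h|`. -/
def maxStates (P : POMDP S X A) : ℕ :=
  (Finset.range P.horizon).sup fun h => Fintype.card (S h)

/-- The expected log-likelihood
`E [ log q(π^lat_t(s_t) | x_{t-L+1:t}, a_{t-L:t-1}) ]` of an `L`-step rule `q` at step `t`, where the
trajectory is drawn from the policy `ρ` and the label is an action drawn from `π^lat_t(s_t)`. It is
`-∞` when `q` misses a label of positive probability. -/
def logLikelihood (P : POMDP S X A) (ρ : Policy S X A) (πlat : LatentPolicy S A) {L t : ℕ}
    (q : LStepRule X A L t) : EReal :=
  ∑ τ : Traj S X A (t + 1), ∑ b : A t,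
    ((P.law ρ (t + 1) τ * πlat t (τ.1 (Fin.last t)) b : ℝ) : EReal)
      * ENNReal.log (ENNReal.ofReal
          (q (obsWindow L t τ.2.1) (actWindow L t fun i => τ.2.2 i.castSucc) b))

/-- `π` is an output of the Forward algorithm with `L`-step random actions and expert `π^lat` in the
infinite-sample limit: at each step `t`, the rule `π_t` maximizes, among all `L`-step rules, the
expected log-likelihood of the expert's action, over trajectories that follow `π` at the steps
before `t - L` and then play uniformly random actions. -/
def IsForwardOutput [∀ h, Nonempty (A h)] (P : POMDP S X A) (πlat : LatentPolicy S A) {L : ℕ}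
    (π : LStepPolicy X A L) : Prop :=
  ∀ t, t < P.horizon → ∀ q : LStepRule X A L t,
    P.logLikelihood (rollIn π t) πlat q ≤ P.logLikelihood (rollIn π t) πlat (π t)

/-- `π^lat` has maximal value among the latent policies. -/
def IsOptimalLatent (P : POMDP S X A) (πlat : LatentPolicy S A) : Prop :=
  ∀ π' : LatentPolicy S A, P.value (LatentPolicy.toPolicy π') ≤ P.value (LatentPolicy.toPolicy πlat)

/-- `π` has maximal value among the executable policies. For `L = horizon` the windows are the
whole history, so that `LStepPolicy X A P.horizon` is the class of all executable policies. -/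
def IsOptimalExecutable (P : POMDP S X A) (π : LStepPolicy X A P.horizon) : Prop :=
  ∀ π' : LStepPolicy X A P.horizon,
    P.value (LStepPolicy.toPolicy π') ≤ P.value (LStepPolicy.toPolicy π)

end POMDP

end

/-!
The imitation error is split over the steps: by a hybrid argument (`POMDP.tvDist_law_le`), the
trajectory laws of the expert and of the output `π` of Forward differ by at most the sum over `t`
of the expected distance, under `π`, of the two decisions at step `t`. By the equality case of
Gibbs' inequality, a maximizer of the expected log-likelihood plays the expert's action at a latent
state drawn from the posterior given the windows, under the roll-in law
(`POMDP.maximizer_eq_posterior`). Hence step `t` costs at most the expected posterior weight of the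
states other than the current one (`POMDP.wrongWeight`). Two regimes are treated separately.

* If `t ≥ L`, the window starts at the state of step `T = t - L`, whose law under the roll-in is its
  law `D` under `π`. With `F n` the unnormalized Bayes filter of the window, the weight of the wrong
  states is at most the potential `∑ s ≠ s_n, √(F n s / F n s_n)` at `n = t`. Since transitions are
  deterministic, a wrong state at step `n + 1` only has wrong predecessors, so one more observation
  multiplies the expected potential by at most a Bhattacharyya coefficient of two emission laws,
  which is at most `2 √δ`. This holds for any choice of actions. At `n = T` the expected potential
  is `∑ s ≠ s', √(D s * D s') ≤ S`. Altogether step `t` costs at most `(2 √δ) ^ L * S`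
  (`POMDP.histExp_wrongWeight_le_of_le`).

* If `t < L`, the window is the whole history and the posterior is the true one. Paths that end in
  different states differ at every step, so each decoded observation supports at most one of the
  final states, and at most one of these is supported by a majority. For an exact posterior, the
  weight of the wrong states is on average at most twice the probability that the current state has
  no majority, and a Chernoff bound makes this `O((2 √δ) ^ (t + 1))`, and at most `δ` for `t = 0`,
  without a factor `S` (`POMDP.histExp_wrongWeight_le_of_lt`). The sum over `t` is `O(δ)`.

For `δ > 1 / 16` the bound is trivial. The comparison of values uses that total rewards lie in
`[0, 1]`, and an optimal latent policy is at least as good as any policy because every policy has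
the state-action marginals of some latent policy (`POMDP.exists_latentPolicy_value_eq`).
-/

noncomputable section

/-! ### Histories and expectations over them -/

section Extend

variable {Y : ℕ → Type*} {n : ℕ}

/-- Append the entry `y` of layer `n` to a sequence with entries in the layers `0, …, n - 1`. -/
def extend (s : ∀ i : Fin n, Y i) (y : Y n) : ∀ i : Fin (n + 1), Y i :=
  Fin.snoc (α := fun i : Fin (n + 1) => Y i) s y

@[simp] theorem extend_castSucc (s : ∀ i : Fin n, Y i) (y : Y n) (i : Fin n) :
    extend s y i.castSucc = s i :=
  Fin.snoc_castSucc (α := fun i : Fin (n + 1) => Y i) y s i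

@[simp] theorem extend_last (s : ∀ i : Fin n, Y i) (y : Y n) :
    extend s y (Fin.last n) = y :=
  Fin.snoc_last (α := fun i : Fin (n + 1) => Y i) y s

@[simp] theorem extend_zero (s : ∀ i : Fin 0, Y i) (y : Y 0) : extend s y 0 = y :=
  extend_last s y

theorem extend_self (s : ∀ i : Fin (n + 1), Y i) :
    extend (fun i => s i.castSucc) (s (Fin.last n)) = s :=
  Fin.snoc_init_self (α := fun i : Fin (n + 1) => Y i) s

end Extend

theorem PDist.nonneg {α : Type*} [Fintype α] (p : PDist α) (a : α) : 0 ≤ p a := p.2.1 a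

theorem PDist.sum_eq_one {α : Type*} [Fintype α] (p : PDist α) : ∑ a, p a = 1 := p.2.2

theorem uniformDist_pos (α : Type*) [Fintype α] [Nonempty α] (a : α) : 0 < uniformDist α a := by
  change (0 : ℝ) < (Fintype.card α : ℝ)⁻¹
  have := Fintype.card_pos (α := α)
  positivity

/-- Histories available when the action of step `n` is chosen: states and observations up to and
including step `n`, and the actions before it. -/
abbrev Hist (S X A : ℕ → Type*) (n : ℕ) : Type _ :=
  (∀ i : Fin (n + 1), S i) × (∀ i : Fin (n + 1), X i) × (∀ i : Fin n, A i)

section Equivs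

variable {S X A : ℕ → Type*}

/-- A history of step `n + 1` is one of step `n`, an action, a state and an observation. -/
def histEquiv (n : ℕ) : Hist S X A n × A n × S (n + 1) × X (n + 1) ≃ Hist S X A (n + 1) where
  toFun p := (extend p.1.1 p.2.2.1, extend p.1.2.1 p.2.2.2, extend p.1.2.2 p.2.1)
  invFun h := ((fun i => h.1 i.castSucc, fun i => h.2.1 i.castSucc, fun i => h.2.2 i.castSucc),
    h.2.2 (Fin.last n), h.1 (Fin.last (n + 1)), h.2.1 (Fin.last (n + 1)))
  left_inv p := by simp
  right_inv h := by simp [extend_self]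

/-- A trajectory of `n + 1` steps is a history of step `n` and an action. -/
def trajEquiv (n : ℕ) : Hist S X A n × A n ≃ Traj S X A (n + 1) where
  toFun p := (p.1.1, p.1.2.1, extend p.1.2.2 p.2)
  invFun τ := ((τ.1, τ.2.1, fun i => τ.2.2 i.castSucc), τ.2.2 (Fin.last n))
  left_inv p := by simp
  right_inv τ := by simp [extend_self]

/-- A history of step `0` is a state and an observation. -/
def histZeroEquiv : S 0 × X 0 ≃ Hist S X A 0 where
  toFun p := (extend (fun i => i.elim0) p.1, extend (fun i => i.elim0) p.2, fun i => i.elim0)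
  invFun h := (h.1 (Fin.last 0), h.2.1 (Fin.last 0))
  left_inv p := by simp
  right_inv h := by
    refine Prod.ext ?_ (Prod.ext ?_ ?_)
    · funext i; obtain rfl : i = 0 := Fin.fin_one_eq_zero i; simp
    · funext i; obtain rfl : i = 0 := Fin.fin_one_eq_zero i; simp
    · funext i; exact i.elim0

end Equivs

namespace POMDP

variable {S X A : ℕ → Type*}
  [∀ h, Fintype (S h)] [∀ h, Fintype (X h)] [∀ h, Fintype (A h)]

/-- The law of the history of step `n` under the policy `π`. -/
def histLaw (P : POMDP S X A) (π : Policy S X A) (n : ℕ) (h : Hist S X A n) : ℝ :=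
  P.law π n (fun i => h.1 i.castSucc, fun i => h.2.1 i.castSucc, h.2.2)
    * P.nextState n (fun i => h.1 i.castSucc) h.2.2 (h.1 (Fin.last n))
    * P.emit n (h.1 (Fin.last n)) (h.2.1 (Fin.last n))

/-- The expectation of a function of the history of step `n` under the policy `π`. -/
def histExp (P : POMDP S X A) (π : Policy S X A) (n : ℕ) (g : Hist S X A n → ℝ) : ℝ :=
  ∑ h, P.histLaw π n h * g h

theorem law_succ (P : POMDP S X A) (π : Policy S X A) (n : ℕ) (τ : Traj S X A (n + 1)) :
    P.law π (n + 1) τ = P.histLaw π n (τ.1, τ.2.1, fun i => τ.2.2 i.castSucc)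
      * π n τ.1 τ.2.1 (fun i => τ.2.2 i.castSucc) (τ.2.2 (Fin.last n)) := rfl

theorem law_trajEquiv (P : POMDP S X A) (π : Policy S X A) (n : ℕ) (h : Hist S X A n) (b : A n) :
    P.law π (n + 1) (trajEquiv n (h, b)) = P.histLaw π n h * π n h.1 h.2.1 h.2.2 b := by
  rw [law_succ]
  simp [trajEquiv]

theorem histLaw_histEquiv (P : POMDP S X A) (π : Policy S X A) (n : ℕ) (h : Hist S X A n)
    (b : A n) (s : S (n + 1)) (x : X (n + 1)) :
    P.histLaw π (n + 1) (histEquiv n (h, b, s, x)) =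
      P.histLaw π n h * π n h.1 h.2.1 h.2.2 b * P.trans n (h.1 (Fin.last n)) b s
        * P.emit (n + 1) s x := by
  rw [histLaw, law_succ]
  simp [histEquiv, nextState]

theorem histLaw_zero (P : POMDP S X A) (π : Policy S X A) (s : S 0) (x : X 0) :
    P.histLaw π 0 (histZeroEquiv (s, x)) = P.init s * P.emit 0 s x := by
  simp [histLaw, histZeroEquiv, law, nextState]

theorem law_nonneg (P : POMDP S X A) (π : Policy S X A) :
    ∀ (n : ℕ) (τ : Traj S X A n), 0 ≤ P.law π n τ
  | 0, _ => zero_le_one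
  | n + 1, _ => mul_nonneg (mul_nonneg (mul_nonneg (law_nonneg P π n _) (PDist.nonneg _ _))
      (PDist.nonneg _ _)) (PDist.nonneg _ _)

theorem histLaw_nonneg (P : POMDP S X A) (π : Policy S X A) (n : ℕ) (h : Hist S X A n) :
    0 ≤ P.histLaw π n h :=
  mul_nonneg (mul_nonneg (law_nonneg P π n _) (PDist.nonneg _ _)) (PDist.nonneg _ _)

/-- The first step of the trajectory. -/
theorem histExp_zero (P : POMDP S X A) (π : Policy S X A) (g : Hist S X A 0 → ℝ) :
    P.histExp π 0 g = ∑ s, P.init s * ∑ x, P.emit 0 s x * g (histZeroEquiv (s, x)) := by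
  rw [histExp, ← histZeroEquiv.sum_comp, Fintype.sum_prod_type]
  simp only [histLaw_zero, Finset.mul_sum, mul_assoc]

/-- One step of the trajectory: action, latent transition, emission. -/
theorem histExp_succ (P : POMDP S X A) (π : Policy S X A) (n : ℕ) (g : Hist S X A (n + 1) → ℝ) :
    P.histExp π (n + 1) g = P.histExp π n fun h => ∑ b, π n h.1 h.2.1 h.2.2 b *
      ∑ s, P.trans n (h.1 (Fin.last n)) b s * ∑ x, P.emit (n + 1) s x *
        g (histEquiv n (h, b, s, x)) := by
  rw [histExp, ← (histEquiv n).sum_comp]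
  simp only [Fintype.sum_prod_type (α₁ := Hist S X A n), Fintype.sum_prod_type (α₁ := A n),
    Fintype.sum_prod_type (α₁ := S (n + 1)), histLaw_histEquiv, histExp, Finset.mul_sum, mul_assoc]

theorem sum_law_succ (P : POMDP S X A) (π : Policy S X A) (n : ℕ) (g : Traj S X A (n + 1) → ℝ) :
    ∑ τ, P.law π (n + 1) τ * g τ = P.histExp π n fun h => ∑ b, π n h.1 h.2.1 h.2.2 b *
        g (trajEquiv n (h, b)) := by
  rw [← (trajEquiv n).sum_comp]
  simp only [Fintype.sum_prod_type (α₁ := Hist S X A n), law_trajEquiv, histExp, Finset.mul_sum,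
    mul_assoc]

theorem histExp_mono (P : POMDP S X A) (π : Policy S X A) (n : ℕ) {f g : Hist S X A n → ℝ}
    (hfg : ∀ h, 0 < P.histLaw π n h → f h ≤ g h) : P.histExp π n f ≤ P.histExp π n g := by
  refine Finset.sum_le_sum fun h _ => ?_
  rcases (P.histLaw_nonneg π n h).eq_or_lt with h0 | h0
  · simp [← h0]
  · exact mul_le_mul_of_nonneg_left (hfg h h0) h0.le

theorem histExp_congr (P : POMDP S X A) (π : Policy S X A) (n : ℕ) {f g : Hist S X A n → ℝ}
    (hfg : ∀ h, f h = g h) : P.histExp π n f = P.histExp π n g := by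
  rw [funext hfg]

theorem histExp_const_mul (P : POMDP S X A) (π : Policy S X A) (n : ℕ) (c : ℝ)
    (g : Hist S X A n → ℝ) : P.histExp π n (fun h => c * g h) = c * P.histExp π n g := by
  simp only [histExp, Finset.mul_sum]
  exact Finset.sum_congr rfl fun h _ => by ring

theorem histExp_add (P : POMDP S X A) (π : Policy S X A) (n : ℕ) (f g : Hist S X A n → ℝ) :
    P.histExp π n (fun h => f h + g h) = P.histExp π n f + P.histExp π n g := by
  simp only [histExp, mul_add, Finset.sum_add_distrib]

theorem histExp_sum (P : POMDP S X A) (π : Policy S X A) (n : ℕ) {ι : Type*} (t : Finset ι)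
    (g : ι → Hist S X A n → ℝ) :
    P.histExp π n (fun h => ∑ i ∈ t, g i h) = ∑ i ∈ t, P.histExp π n (g i) := by
  simp only [histExp, Finset.mul_sum]
  exact Finset.sum_comm

theorem histExp_nonneg (P : POMDP S X A) (π : Policy S X A) (n : ℕ) {g : Hist S X A n → ℝ}
    (hg : ∀ h, 0 ≤ g h) : 0 ≤ P.histExp π n g :=
  Finset.sum_nonneg fun h _ => mul_nonneg (P.histLaw_nonneg π n h) (hg h)

theorem histExp_one (P : POMDP S X A) (π : Policy S X A) (n : ℕ) :
    P.histExp π n (fun _ => 1) = 1 := by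
  induction n with
  | zero => simp [histExp_zero]
  | succ n ih => simpa [histExp_succ, PDist.sum_eq_one] using ih

theorem sum_law (P : POMDP S X A) (π : Policy S X A) (n : ℕ) : ∑ τ, P.law π n τ = 1 := by
  cases n with
  | zero => simp [law]
  | succ n =>
    have := P.sum_law_succ π n fun _ => 1
    simp only [mul_one, PDist.sum_eq_one, histExp_one] at this
    exact this

/-- The law of the history of step `n` involves the decisions before step `n` only. -/
theorem histLaw_congr (P : POMDP S X A) {π π' : Policy S X A} (n : ℕ)
    (hπ : ∀ i < n, π i = π' i) (h : Hist S X A n) : P.histLaw π n h = P.histLaw π' n h := by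
  have key : ∀ (m : ℕ), m ≤ n → ∀ τ, P.law π m τ = P.law π' m τ := by
    intro m
    induction m with
    | zero => intro _ _; rfl
    | succ m ih =>
      intro hm τ
      rw [law_succ, law_succ, histLaw, histLaw, ih (by omega), hπ m (by omega)]
  rw [histLaw, histLaw, key n le_rfl]

end POMDP

/-! ### Maximizers of the expected log-likelihood -/

/-- A finite sum of real multiples of logarithms is finite when no argument with a positive
coefficient vanishes. -/
theorem sum_coe_mul_log {ι : Type*} (t : Finset ι) (c q : ι → ℝ) (hc : ∀ i, 0 ≤ c i)
    (hq : ∀ i, 0 < c i → 0 < q i) :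
    ∑ i ∈ t, (c i : EReal) * ENNReal.log (ENNReal.ofReal (q i))
      = ((∑ i ∈ t, c i * Real.log (q i) : ℝ) : EReal) := by
  classical
  induction t using Finset.induction_on with
  | empty => simp
  | insert i t hi ih =>
    rw [Finset.sum_insert hi, Finset.sum_insert hi, ih, EReal.coe_add]
    congr 1
    rcases (hc i).eq_or_lt with h0 | h0
    · simp [← h0]
    · rw [ENNReal.log_ofReal_of_pos (hq i h0), EReal.coe_mul]

theorem sum_coe_mul_log_eq_bot {ι : Type*} (t : Finset ι) (c q : ι → ℝ) {i : ι} (hi : i ∈ t)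
    (hc : 0 < c i) (hq : q i = 0) :
    ∑ i ∈ t, (c i : EReal) * ENNReal.log (ENNReal.ofReal (q i)) = ⊥ := by
  classical
  rw [← Finset.add_sum_erase t _ hi, hq, ENNReal.ofReal_zero, ENNReal.log_zero,
    EReal.coe_mul_bot_of_pos hc, EReal.bot_add]

/-- The equality case of Gibbs' inequality. -/
theorem PDist.eq_of_cross_entropy_le {α : Type*} [Fintype α] (p q : PDist α)
    (hpq : ∀ a, 0 < p a → 0 < q a)
    (h : 0 ≤ ∑ a, p a * (Real.log (q a) - Real.log (p a))) (a : α) : q a = p a := by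
  have hle : ∀ a, p a * (Real.log (q a) - Real.log (p a)) ≤ q a - p a := by
    intro a
    rcases (p.nonneg a).eq_or_lt with h0 | h0
    · rw [← h0]; simp [q.nonneg a]
    · have := Real.log_le_sub_one_of_pos (div_pos (hpq a h0) h0)
      rw [Real.log_div (hpq a h0).ne' h0.ne'] at this
      calc _ ≤ p a * (q a / p a - 1) := mul_le_mul_of_nonneg_left this h0.le
        _ = _ := by field_simp
  have hsum : ∑ a, (q a - p a) = 0 := by
    rw [Finset.sum_sub_distrib, p.sum_eq_one, q.sum_eq_one, sub_self]
  have heq := (Finset.sum_eq_sum_iff_of_le fun a _ => hle a).1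
    (le_antisymm (Finset.sum_le_sum fun a _ => hle a) (hsum ▸ h)) a (Finset.mem_univ a)
  rcases (p.nonneg a).eq_or_lt with h0 | h0
  · rw [← h0] at heq ⊢; simp at heq; exact heq.symm
  · by_contra hne
    have hq := hpq a h0
    have := Real.log_lt_sub_one_of_pos (div_pos hq h0) fun h1 =>
      hne ((div_eq_one_iff_eq h0.ne').1 h1)
    rw [Real.log_div hq.ne' h0.ne'] at this
    have h2 := mul_lt_mul_of_pos_left this h0
    rw [heq] at h2
    have : p a * (q a / p a - 1) = q a - p a := by field_simp
    linarith

namespace POMDP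

variable {S X A : ℕ → Type*}
  [∀ h, Fintype (S h)] [∀ h, Fintype (X h)] [∀ h, Fintype (A h)]

open scoped Classical in
/-- The probability, under the policy `ρ`, that the observation and action windows of step `t` are
`o` and `a` and that the latent state is `s`. As a function of `s`, this is the unnormalized
posterior law of the latent state given the windows. -/
def windowWeight (P : POMDP S X A) (ρ : Policy S X A) (L t : ℕ) (o : ObsWindow X L t)
    (a : ActWindow A L t) (s : S t) : ℝ :=
  P.histExp ρ t fun h =>
    if (obsWindow L t h.2.1 = o ∧ actWindow L t h.2.2 = a) ∧ h.1 (Fin.last t) = s then 1 else 0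

theorem windowWeight_nonneg (P : POMDP S X A) (ρ : Policy S X A) (L t : ℕ) (o : ObsWindow X L t)
    (a : ActWindow A L t) (s : S t) : 0 ≤ P.windowWeight ρ L t o a s := by
  refine P.histExp_nonneg ρ t fun h => ?_
  split_ifs <;> simp

theorem histLaw_le_windowWeight (P : POMDP S X A) (ρ : Policy S X A) (L t : ℕ)
    (h : Hist S X A t) : P.histLaw ρ t h ≤
      P.windowWeight ρ L t (obsWindow L t h.2.1) (actWindow L t h.2.2) (h.1 (Fin.last t)) := by
  classical
  rw [windowWeight, histExp]
  refine le_trans (by simp) (Finset.single_le_sum (f := fun k => P.histLaw ρ t k * if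
    (obsWindow L t k.2.1 = obsWindow L t h.2.1 ∧ actWindow L t k.2.2 = actWindow L t h.2.2) ∧
      k.1 (Fin.last t) = h.1 (Fin.last t) then 1 else 0) (fun k _ => ?_) (Finset.mem_univ h))
  refine mul_nonneg (P.histLaw_nonneg ρ t k) ?_
  split_ifs <;> simp

open scoped Classical in
theorem histExp_window (P : POMDP S X A) (ρ : Policy S X A) (L t : ℕ) (o : ObsWindow X L t)
    (a : ActWindow A L t) (G : S t → ℝ) :
    P.histExp ρ t (fun h => if obsWindow L t h.2.1 = o ∧ actWindow L t h.2.2 = a then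
      G (h.1 (Fin.last t)) else 0) = ∑ s, P.windowWeight ρ L t o a s * G s := by
  have : ∀ h : Hist S X A t, (if obsWindow L t h.2.1 = o ∧ actWindow L t h.2.2 = a then
      G (h.1 (Fin.last t)) else 0) = ∑ s, G s * (if (obsWindow L t h.2.1 = o ∧
        actWindow L t h.2.2 = a) ∧ h.1 (Fin.last t) = s then 1 else 0) := by
    intro h
    by_cases hw : obsWindow L t h.2.1 = o ∧ actWindow L t h.2.2 = a <;> simp [hw]
  rw [P.histExp_congr ρ t this, histExp_sum]
  refine Finset.sum_congr rfl fun s _ => ?_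
  rw [histExp_const_mul, windowWeight, mul_comm]

/-- The real form of the expected log-likelihood, when it is finite. -/
theorem logLikelihood_eq_coe (P : POMDP S X A) (ρ : Policy S X A) (πlat : LatentPolicy S A)
    {L t : ℕ} (q : LStepRule X A L t)
    (hq : ∀ (h : Hist S X A t) (b : A t), 0 < P.histLaw ρ t h → 0 < πlat t (h.1 (Fin.last t)) b →
      0 < q (obsWindow L t h.2.1) (actWindow L t h.2.2) b) :
    P.logLikelihood ρ πlat q = ((P.histExp ρ t fun h => ∑ b, πlat t (h.1 (Fin.last t)) b *
      Real.log (q (obsWindow L t h.2.1) (actWindow L t h.2.2) b) : ℝ) : EReal) := by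
  rw [logLikelihood, ← Fintype.sum_prod_type' (f := fun (τ : Traj S X A (t + 1)) (b : A t) =>
    ((P.law ρ (t + 1) τ * πlat t (τ.1 (Fin.last t)) b : ℝ) : EReal)
      * ENNReal.log (ENNReal.ofReal
          (q (obsWindow L t τ.2.1) (actWindow L t fun i => τ.2.2 i.castSucc) b))),
    sum_coe_mul_log Finset.univ (fun p : Traj S X A (t + 1) × A t =>
      P.law ρ (t + 1) p.1 * πlat t (p.1.1 (Fin.last t)) p.2)
      (fun p => q (obsWindow L t p.1.2.1) (actWindow L t fun i => p.1.2.2 i.castSucc) p.2)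
      (fun p => mul_nonneg (P.law_nonneg ρ _ _) (PDist.nonneg _ _))]
  · congr 1
    rw [Fintype.sum_prod_type]
    simp only [mul_assoc, ← Finset.mul_sum]
    rw [sum_law_succ]
    refine P.histExp_congr ρ t fun h => ?_
    simp [trajEquiv, ← Finset.sum_mul]
  · rintro ⟨τ, b⟩ hpos
    have h1 := pos_of_mul_pos_left hpos (PDist.nonneg _ _)
    have h2 := pos_of_mul_pos_right hpos (P.law_nonneg ρ _ _)
    rw [law_succ] at h1
    exact hq (τ.1, τ.2.1, fun i => τ.2.2 i.castSucc) b
      (pos_of_mul_pos_left h1 (PDist.nonneg _ _)) h2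

theorem logLikelihood_eq_bot (P : POMDP S X A) (ρ : Policy S X A) (πlat : LatentPolicy S A)
    {L t : ℕ} (q : LStepRule X A L t) (h : Hist S X A t) (b : A t) (hh : 0 < P.histLaw ρ t h)
    (hb : 0 < πlat t (h.1 (Fin.last t)) b)
    (hq : q (obsWindow L t h.2.1) (actWindow L t h.2.2) b = 0) :
    P.logLikelihood ρ πlat q = ⊥ := by
  obtain ⟨b', hb'⟩ : ∃ b', 0 < ρ t h.1 h.2.1 h.2.2 b' := by
    by_contra! hcon
    have := PDist.sum_eq_one (ρ t h.1 h.2.1 h.2.2)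
    linarith [Finset.sum_nonpos fun b' (_ : b' ∈ Finset.univ) => hcon b']
  rw [logLikelihood, ← Fintype.sum_prod_type' (f := fun (τ : Traj S X A (t + 1)) (b : A t) =>
    ((P.law ρ (t + 1) τ * πlat t (τ.1 (Fin.last t)) b : ℝ) : EReal)
      * ENNReal.log (ENNReal.ofReal
          (q (obsWindow L t τ.2.1) (actWindow L t fun i => τ.2.2 i.castSucc) b)))]
  refine sum_coe_mul_log_eq_bot Finset.univ (fun p : Traj S X A (t + 1) × A t =>
      P.law ρ (t + 1) p.1 * πlat t (p.1.1 (Fin.last t)) p.2)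
      (fun p => q (obsWindow L t p.1.2.1) (actWindow L t fun i => p.1.2.2 i.castSucc) p.2)
      (Finset.mem_univ (trajEquiv t (h, b'), b)) ?_ ?_
  · rw [law_trajEquiv]
    exact mul_pos (mul_pos hh hb') (by simpa [trajEquiv] using hb)
  · simpa [trajEquiv] using hq

/-- A rule that maximizes the expected log-likelihood draws a latent state from the posterior given
the windows, and then an action from the expert's decision in that state. -/
theorem maximizer_eq_posterior [∀ h, Nonempty (A h)] (P : POMDP S X A) (ρ : Policy S X A)
    (πlat : LatentPolicy S A) {L t : ℕ} (q : LStepRule X A L t)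
    (hq : ∀ q' : LStepRule X A L t, P.logLikelihood ρ πlat q' ≤ P.logLikelihood ρ πlat q)
    (o : ObsWindow X L t) (a : ActWindow A L t) (b : A t) :
    q o a b * ∑ s, P.windowWeight ρ L t o a s
      = ∑ s, P.windowWeight ρ L t o a s * πlat t s b := by
  classical
  set Z := ∑ s, P.windowWeight ρ L t o a s with hZ
  have hW := P.windowWeight_nonneg ρ L t o a
  rcases (Finset.sum_nonneg fun s (_ : s ∈ Finset.univ) => hW s).eq_or_lt with h0 | hZpos
  · have hz : ∀ s, P.windowWeight ρ L t o a s = 0 := fun s =>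
      (Finset.sum_eq_zero_iff_of_nonneg fun s _ => hW s).1 h0.symm s (Finset.mem_univ s)
    simp [hZ, hz]
  rw [← hZ] at hZpos
  -- The likelihood of the maximizer is finite, as that of the uniform rule is.
  have hgood : ∀ (h : Hist S X A t) (b : A t), 0 < P.histLaw ρ t h →
      0 < πlat t (h.1 (Fin.last t)) b →
      0 < q (obsWindow L t h.2.1) (actWindow L t h.2.2) b := by
    intro h b hh hb
    refine (PDist.nonneg _ b).lt_of_ne fun hqb => ?_
    have h1 := hq fun _ _ => uniformDist (A t)
    rw [P.logLikelihood_eq_bot ρ πlat q h b hh hb hqb.symm, logLikelihood_eq_coe] at h1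
    · exact EReal.coe_ne_bot _ (le_bot_iff.1 h1)
    · exact fun _ b _ _ => uniformDist_pos _ b
  let p : PDist (A t) := ⟨fun b => (∑ s, P.windowWeight ρ L t o a s * πlat t s b) / Z,
    fun b => div_nonneg (Finset.sum_nonneg fun s _ => mul_nonneg (hW s) (PDist.nonneg _ b))
      hZpos.le, by
      rw [← Finset.sum_div, Finset.sum_comm]
      simp only [← Finset.mul_sum, PDist.sum_eq_one, mul_one]
      exact div_self hZpos.ne'⟩
  have hp : ∀ b, p b * Z = ∑ s, P.windowWeight ρ L t o a s * πlat t s b := fun b =>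
    div_mul_cancel₀ _ hZpos.ne'
  -- Compare with the rule that is replaced by the posterior mixture at the windows `o`, `a`.
  let q' : LStepRule X A L t := fun o' a' => if o' = o ∧ a' = a then p else q o' a'
  have hle := hq q'
  rw [P.logLikelihood_eq_coe ρ πlat q hgood, P.logLikelihood_eq_coe ρ πlat q' ?_,
    EReal.coe_le_coe_iff] at hle
  · have hdiff : (0 : ℝ) ≤ P.histExp ρ t fun h =>
        if obsWindow L t h.2.1 = o ∧ actWindow L t h.2.2 = a then
          (fun s => ∑ b, πlat t s b * (Real.log (q o a b) - Real.log (p b))) (h.1 (Fin.last t))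
        else 0 := by
      rw [← sub_nonneg, histExp, histExp, ← Finset.sum_sub_distrib] at hle
      refine hle.trans_eq (Finset.sum_congr rfl fun h _ => ?_)
      rw [← mul_sub, ← Finset.sum_sub_distrib]
      congr 1
      by_cases hw : obsWindow L t h.2.1 = o ∧ actWindow L t h.2.2 = a
      · simp [q', hw, mul_sub]
      · simp [q', hw]
    rw [P.histExp_window ρ L t o a
      fun s => ∑ b, πlat t s b * (Real.log (q o a b) - Real.log (p b))] at hdiff
    have hcross : 0 ≤ ∑ b, p b * (Real.log (q o a b) - Real.log (p b)) := by
      refine nonneg_of_mul_nonneg_right (a := Z) (hdiff.trans_eq ?_) hZpos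
      simp only [Finset.mul_sum]
      rw [Finset.sum_comm]
      refine Finset.sum_congr rfl fun b _ => ?_
      simp only [← mul_assoc]
      rw [← Finset.sum_mul, ← hp, mul_comm Z]
    rw [PDist.eq_of_cross_entropy_le p (q o a) ?_ hcross b, hp]
    intro b hb
    have h1 : 0 < ∑ s, P.windowWeight ρ L t o a s * πlat t s b := hp b ▸ mul_pos hb hZpos
    obtain ⟨s, -, hs⟩ := Finset.exists_lt_of_sum_lt (f := fun _ => (0 : ℝ)) (by simpa using h1)
    have h2 := pos_of_mul_pos_left hs (PDist.nonneg _ _)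
    have h3 := pos_of_mul_pos_right hs (hW s)
    rw [windowWeight, histExp] at h2
    obtain ⟨h, -, hh⟩ := Finset.exists_lt_of_sum_lt (f := fun _ => (0 : ℝ))
      ((Finset.sum_const_zero).trans_lt h2)
    have h4 : (obsWindow L t h.2.1 = o ∧ actWindow L t h.2.2 = a) ∧ h.1 (Fin.last t) = s := by
      by_contra hne
      simp [hne] at hh
    obtain ⟨⟨rfl, rfl⟩, rfl⟩ := h4
    exact hgood h b (by simpa using hh) h3
  · intro h b hh hb
    by_cases hw : obsWindow L t h.2.1 = o ∧ actWindow L t h.2.2 = a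
    · simp only [q', hw, and_self, if_true]
      refine pos_of_mul_pos_left ?_ hZpos.le
      rw [hp]
      obtain ⟨rfl, rfl⟩ := hw
      refine (mul_pos (hh.trans_le (P.histLaw_le_windowWeight ρ L t h)) hb).trans_le ?_
      exact Finset.single_le_sum (f := fun s => P.windowWeight ρ L t _ _ s * πlat t s b)
        (fun s _ => mul_nonneg (hW s) (PDist.nonneg _ _)) (Finset.mem_univ _)
    · simp only [q', hw, if_false]
      exact hgood h b hh hb

end POMDP

/-! ### Total variation distance and values -/

theorem tvDist_le_one {α : Type*} [Fintype α] {p q : α → ℝ} (hp : ∀ a, 0 ≤ p a)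
    (hq : ∀ a, 0 ≤ q a) (hp1 : ∑ a, p a = 1) (hq1 : ∑ a, q a = 1) : tvDist p q ≤ 1 := by
  have : ∑ a, |p a - q a| ≤ ∑ a, (p a + q a) := Finset.sum_le_sum fun a _ =>
    abs_le.2 ⟨by linarith [hp a, hq a], by linarith [hp a, hq a]⟩
  rw [Finset.sum_add_distrib, hp1, hq1] at this
  unfold tvDist
  linarith

theorem PDist.tvDist_le_one {α : Type*} [Fintype α] (p q : PDist α) : tvDist p q ≤ 1 :=
  _root_.tvDist_le_one p.nonneg q.nonneg p.sum_eq_one q.sum_eq_one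

/-- The expectations of a function with values in `[0, 1]` under two laws of the same mass differ
by at most the total variation distance. -/
theorem sum_mul_sub_sum_mul_le_tvDist {α : Type*} [Fintype α] {p q R : α → ℝ}
    (hpq : ∑ a, p a = ∑ a, q a) (hR0 : ∀ a, 0 ≤ R a) (hR1 : ∀ a, p a ≠ 0 ∨ q a ≠ 0 → R a ≤ 1) :
    ∑ a, p a * R a - ∑ a, q a * R a ≤ tvDist p q := by
  have h1 : ∑ a, p a * R a - ∑ a, q a * R a = ∑ a, (p a - q a) * (R a - 1 / 2) := by
    simp only [sub_mul, mul_sub, Finset.sum_sub_distrib, ← Finset.sum_mul, hpq]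
    ring
  rw [h1, tvDist, Finset.mul_sum]
  refine Finset.sum_le_sum fun a _ => ?_
  by_cases h : p a ≠ 0 ∨ q a ≠ 0
  · refine (le_abs_self _).trans ?_
    rw [abs_mul, mul_comm]
    refine mul_le_mul_of_nonneg_right (abs_le.2 ⟨?_, ?_⟩) (abs_nonneg _) <;>
      linarith [hR0 a, hR1 a h]
  · push Not at h
    simp [h.1, h.2]

/-- The distance from one component to a mixture is at most the weight of the other components. -/
theorem PDist.tvDist_mixture_le {α σ : Type*} [Fintype α] [Fintype σ] [DecidableEq σ]
    (p : σ → PDist α) (q : PDist α) (w : σ → ℝ) (hw : ∀ s, 0 ≤ w s) (hpos : 0 < ∑ s, w s)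
    (hq : ∀ a, q a * ∑ s, w s = ∑ s, w s * p s a) (s₀ : σ) :
    tvDist (p s₀) q ≤ ∑ s ∈ Finset.univ.erase s₀, w s / ∑ s, w s := by
  set Z := ∑ s, w s with hZ
  have hq' : ∀ a, q a = ∑ s, w s / Z * p s a := by
    intro a
    rw [eq_div_of_mul_eq hpos.ne' (hq a), Finset.sum_div]
    exact Finset.sum_congr rfl fun s _ => by ring
  have hp' : ∀ a, p s₀ a = ∑ s, w s / Z * p s₀ a := by
    intro a
    rw [← Finset.sum_mul, ← Finset.sum_div, ← hZ, div_self hpos.ne', one_mul]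
  calc tvDist (p s₀) q
      ≤ 1 / 2 * ∑ a, ∑ s, w s / Z * |p s₀ a - p s a| := by
        refine mul_le_mul_of_nonneg_left (Finset.sum_le_sum fun a _ => ?_) (by norm_num)
        nth_rewrite 1 [hq' a, hp' a]
        rw [← Finset.sum_sub_distrib]
        refine (Finset.abs_sum_le_sum_abs _ _).trans_eq (Finset.sum_congr rfl fun s _ => ?_)
        rw [← mul_sub, abs_mul, abs_of_nonneg (div_nonneg (hw s) hpos.le)]
    _ = ∑ s, w s / Z * tvDist (p s₀) (p s) := by
        rw [Finset.sum_comm, Finset.mul_sum]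
        refine Finset.sum_congr rfl fun s _ => ?_
        rw [← Finset.mul_sum, tvDist]
        ring
    _ = ∑ s ∈ Finset.univ.erase s₀, w s / Z * tvDist (p s₀) (p s) := by
        rw [Finset.sum_erase]
        simp [tvDist]
    _ ≤ _ := Finset.sum_le_sum fun s _ =>
        mul_le_of_le_one_right (div_nonneg (hw s) hpos.le) ((p s₀).tvDist_le_one (p s))

namespace POMDP

variable {S X A : ℕ → Type*}
  [∀ h, Fintype (S h)] [∀ h, Fintype (X h)] [∀ h, Fintype (A h)]

theorem sum_abs_law_succ_sub_le (P : POMDP S X A) (π π' : Policy S X A) (n : ℕ) :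
    ∑ τ, |P.law π (n + 1) τ - P.law π' (n + 1) τ| ≤
      ∑ h, |P.histLaw π n h - P.histLaw π' n h| +
        2 * P.histExp π' n fun h => tvDist (π n h.1 h.2.1 h.2.2) (π' n h.1 h.2.1 h.2.2) := by
  rw [← (trajEquiv n).sum_comp, Fintype.sum_prod_type, histExp, Finset.mul_sum,
    ← Finset.sum_add_distrib]
  refine Finset.sum_le_sum fun h _ => ?_
  calc ∑ b, |P.law π (n + 1) (trajEquiv n (h, b)) - P.law π' (n + 1) (trajEquiv n (h, b))|
      ≤ ∑ b, (|P.histLaw π n h - P.histLaw π' n h| * π n h.1 h.2.1 h.2.2 b +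
          P.histLaw π' n h * |π n h.1 h.2.1 h.2.2 b - π' n h.1 h.2.1 h.2.2 b|) := by
        refine Finset.sum_le_sum fun b _ => ?_
        have h1 := P.histLaw_nonneg π' n h
        have h2 := PDist.nonneg (π n h.1 h.2.1 h.2.2) b
        rw [law_trajEquiv, law_trajEquiv]
        have h3 := abs_add_le ((P.histLaw π n h - P.histLaw π' n h) * π n h.1 h.2.1 h.2.2 b)
          (P.histLaw π' n h * (π n h.1 h.2.1 h.2.2 b - π' n h.1 h.2.1 h.2.2 b))
        rw [abs_mul, abs_mul, abs_of_nonneg h1, abs_of_nonneg h2] at h3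
        refine le_trans (le_of_eq ?_) h3
        congr 1
        ring
    _ = _ := by
        rw [Finset.sum_add_distrib, ← Finset.mul_sum, ← Finset.mul_sum, PDist.sum_eq_one, tvDist]
        ring

theorem sum_abs_histLaw_succ_sub_le (P : POMDP S X A) (π π' : Policy S X A) (n : ℕ) :
    ∑ h, |P.histLaw π (n + 1) h - P.histLaw π' (n + 1) h| ≤
      ∑ τ, |P.law π (n + 1) τ - P.law π' (n + 1) τ| := by
  rw [← (histEquiv n).sum_comp, ← (trajEquiv n).sum_comp]
  refine le_of_eq ?_
  simp only [Fintype.sum_prod_type (α₁ := Hist S X A n), Fintype.sum_prod_type (α₁ := A n),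
    Fintype.sum_prod_type (α₁ := S (n + 1)), histLaw_histEquiv, law_trajEquiv, ← sub_mul, abs_mul,
    abs_of_nonneg (PDist.nonneg _ _), ← Finset.mul_sum, PDist.sum_eq_one, mul_one]

/-- The laws of the trajectory under two policies differ by at most the expected disagreement of
the policies, summed over the steps. -/
theorem tvDist_law_le (P : POMDP S X A) (π π' : Policy S X A) (n : ℕ) :
    tvDist (P.law π n) (P.law π' n) ≤ ∑ t ∈ Finset.range n,
      P.histExp π' t fun h => tvDist (π t h.1 h.2.1 h.2.2) (π' t h.1 h.2.1 h.2.2) := by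
  have key : ∀ n, ∑ h, |P.histLaw π n h - P.histLaw π' n h| ≤ 2 * ∑ t ∈ Finset.range n,
      P.histExp π' t fun h => tvDist (π t h.1 h.2.1 h.2.2) (π' t h.1 h.2.1 h.2.2) := by
    intro n
    induction n with
    | zero => simp [P.histLaw_congr (π := π) (π' := π') 0 (by simp)]
    | succ n ih =>
      rw [Finset.sum_range_succ, mul_add]
      linarith [P.sum_abs_histLaw_succ_sub_le π π' n, P.sum_abs_law_succ_sub_le π π' n]
  cases n with
  | zero => simp [tvDist, law]
  | succ n =>
    rw [Finset.sum_range_succ, tvDist]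
    linarith [key n, P.sum_abs_law_succ_sub_le π π' n]

theorem tvDist_trajLaw_le_one (P : POMDP S X A) (π π' : Policy S X A) :
    tvDist (P.trajLaw π) (P.trajLaw π') ≤ 1 :=
  tvDist_le_one (P.law_nonneg π _) (P.law_nonneg π' _) (P.sum_law π _) (P.sum_law π' _)

theorem tvDist_latentLaw_le (P : POMDP S X A) (π π' : Policy S X A) :
    tvDist (P.latentLaw π) (P.latentLaw π') ≤ tvDist (P.trajLaw π) (P.trajLaw π') := by
  refine mul_le_mul_of_nonneg_left ?_ (by norm_num)
  rw [Fintype.sum_prod_type, Fintype.sum_prod_type]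
  refine Finset.sum_le_sum fun s _ => ?_
  rw [Fintype.sum_prod_type, Finset.sum_comm]
  refine Finset.sum_le_sum fun a _ => ?_
  rw [latentLaw, latentLaw, ← Finset.sum_sub_distrib]
  exact Finset.abs_sum_le_sum_abs _ _

theorem sum_latentLaw_mul (P : POMDP S X A) (π : Policy S X A)
    (R : (∀ i : Fin P.horizon, S i) × (∀ i : Fin P.horizon, A i) → ℝ) :
    ∑ σ, P.latentLaw π σ * R σ = ∑ τ, P.trajLaw π τ * R (τ.1, τ.2.2) := by
  rw [Fintype.sum_prod_type, Fintype.sum_prod_type]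
  refine Finset.sum_congr rfl fun s _ => ?_
  rw [Fintype.sum_prod_type, Finset.sum_comm]
  refine Finset.sum_congr rfl fun a _ => ?_
  rw [latentLaw, Finset.sum_mul]

theorem value_sub_value_le_tvDist (P : POMDP S X A) (hP : P.RewardsAtMostOne)
    (π π' : Policy S X A) :
    P.value π - P.value π' ≤ tvDist (P.latentLaw π) (P.latentLaw π') := by
  let R : (∀ i : Fin P.horizon, S i) × (∀ i : Fin P.horizon, A i) → ℝ :=
    fun σ => ∑ i : Fin P.horizon, P.reward i (σ.1 i) (σ.2 i)
  have hval : ∀ π, P.value π = ∑ σ, P.latentLaw π σ * R σ := fun π =>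
    (P.sum_latentLaw_mul π R).symm
  have hmass : ∀ π, ∑ σ, P.latentLaw π σ = 1 := by
    intro π
    have := P.sum_latentLaw_mul π fun _ => 1
    simp only [mul_one] at this
    exact this.trans (P.sum_law π _)
  have hR1 : ∀ π σ, P.latentLaw π σ ≠ 0 → R σ ≤ 1 := by
    intro π σ h
    obtain ⟨x, -, hx⟩ := Finset.exists_ne_zero_of_sum_ne_zero h
    exact hP π (σ.1, x, σ.2) hx
  rw [hval, hval]
  exact sum_mul_sub_sum_mul_le_tvDist ((hmass π).trans (hmass π').symm)
    (fun σ => Finset.sum_nonneg fun i _ => (P.reward_mem _ _ _).1)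
    fun σ h => h.elim (hR1 π σ) (hR1 π' σ)

theorem histExp_prefix (P : POMDP S X A) (π : Policy S X A) (n : ℕ) (G : Traj S X A n → ℝ) :
    P.histExp π n (fun h => G (fun i => h.1 i.castSucc, fun i => h.2.1 i.castSucc, h.2.2))
      = ∑ τ, P.law π n τ * G τ := by
  cases n with
  | zero =>
    have hG : ∀ τ τ' : Traj S X A 0, G τ = G τ' := fun τ τ' => congrArg G (Subsingleton.elim _ _)
    let τ₀ : Traj S X A 0 := (fun i => i.elim0, fun i => i.elim0, fun i => i.elim0)
    simp only [hG _ τ₀, ← Finset.sum_mul, sum_law]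
    simpa [histExp_one] using P.histExp_const_mul π 0 (G τ₀) fun _ => 1
  | succ n =>
    rw [histExp_succ, sum_law_succ]
    refine P.histExp_congr π n fun h => Finset.sum_congr rfl fun b _ => ?_
    simp [histEquiv, trajEquiv, ← Finset.sum_mul]

theorem value_eq_sum (P : POMDP S X A) (π : Policy S X A) :
    P.value π = ∑ i ∈ Finset.range P.horizon, P.histExp π i fun h =>
      ∑ b, π i h.1 h.2.1 h.2.2 b * P.reward i (h.1 (Fin.last i)) b := by
  have key : ∀ n, ∑ τ : Traj S X A n, P.law π n τ * ∑ i : Fin n, P.reward i (τ.1 i) (τ.2.2 i)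
      = ∑ i ∈ Finset.range n, P.histExp π i fun h =>
        ∑ b, π i h.1 h.2.1 h.2.2 b * P.reward i (h.1 (Fin.last i)) b := by
    intro n
    induction n with
    | zero => simp
    | succ n ih =>
      rw [Finset.sum_range_succ, ← ih, sum_law_succ, ← P.histExp_prefix π n fun τ =>
        ∑ i : Fin n, P.reward i (τ.1 i) (τ.2.2 i), ← histExp_add]
      refine P.histExp_congr π n fun h => ?_
      simp [trajEquiv, Fin.sum_univ_castSucc, mul_add, Finset.sum_add_distrib, ← Finset.sum_mul]
  exact key _

open scoped Classical in
/-- The law of the latent state of step `n` under the policy `π`. -/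
def stateLaw (P : POMDP S X A) (π : Policy S X A) (n : ℕ) (s : S n) : ℝ :=
  P.histExp π n fun h => if h.1 (Fin.last n) = s then 1 else 0

theorem stateLaw_nonneg (P : POMDP S X A) (π : Policy S X A) (n : ℕ) (s : S n) :
    0 ≤ P.stateLaw π n s :=
  P.histExp_nonneg π n fun h => by split_ifs <;> simp

theorem histExp_last (P : POMDP S X A) (π : Policy S X A) (n : ℕ) (f : S n → ℝ) :
    P.histExp π n (fun h => f (h.1 (Fin.last n))) = ∑ s, P.stateLaw π n s * f s := by
  classical
  have : ∀ h : Hist S X A n, f (h.1 (Fin.last n)) =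
      ∑ s, f s * if h.1 (Fin.last n) = s then 1 else 0 := fun h => by simp
  rw [P.histExp_congr π n this, histExp_sum]
  refine Finset.sum_congr rfl fun s _ => ?_
  rw [histExp_const_mul, mul_comm, stateLaw]

theorem sum_stateLaw (P : POMDP S X A) (π : Policy S X A) (n : ℕ) :
    ∑ s, P.stateLaw π n s = 1 := by
  simpa [histExp_one] using (P.histExp_last π n fun _ => 1).symm

/-- Every policy has the same state-action marginals as some latent policy, namely the one that
plays the conditional law of the action given the current latent state. -/
theorem exists_latentPolicy_value_eq [∀ h, Nonempty (A h)] (P : POMDP S X A) (π : Policy S X A) :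
    ∃ π' : LatentPolicy S A, P.value (LatentPolicy.toPolicy π') = P.value π := by
  classical
  let j : ∀ n, S n → A n → ℝ := fun n s b =>
    P.histExp π n fun h => if h.1 (Fin.last n) = s then π n h.1 h.2.1 h.2.2 b else 0
  have hj : ∀ n s b, 0 ≤ j n s b := fun n s b => P.histExp_nonneg π n fun h => by
    split_ifs
    exacts [PDist.nonneg _ _, le_rfl]
  have hjm : ∀ n s, ∑ b, j n s b = P.stateLaw π n s := by
    intro n s
    rw [← histExp_sum, stateLaw]
    refine P.histExp_congr π n fun h => ?_
    split_ifs
    exacts [PDist.sum_eq_one _, by simp]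
  let π' : LatentPolicy S A := fun n s =>
    if hs : P.stateLaw π n s = 0 then uniformDist (A n) else
      ⟨fun b => j n s b / P.stateLaw π n s,
        fun b => div_nonneg (hj n s b) (P.stateLaw_nonneg π n s), by
        rw [← Finset.sum_div, hjm, div_self hs]⟩
  have hπ' : ∀ n s b, P.stateLaw π n s * π' n s b = j n s b := by
    intro n s b
    by_cases hs : P.stateLaw π n s = 0
    · rw [hs, zero_mul]
      exact ((Finset.sum_eq_zero_iff_of_nonneg fun b _ => hj n s b).1 ((hjm n s).trans hs) b
        (Finset.mem_univ b)).symm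
    · simp only [π', hs, dite_false]
      exact mul_div_cancel₀ _ hs
  have hj_sum : ∀ n (g : S n → A n → ℝ), P.histExp π n (fun h =>
      ∑ b, π n h.1 h.2.1 h.2.2 b * g (h.1 (Fin.last n)) b) = ∑ s, ∑ b, j n s b * g s b := by
    intro n g
    have : ∀ h : Hist S X A n, ∑ b, π n h.1 h.2.1 h.2.2 b * g (h.1 (Fin.last n)) b =
        ∑ s, ∑ b, g s b * if h.1 (Fin.last n) = s then π n h.1 h.2.1 h.2.2 b else 0 := by
      intro h
      rw [Finset.sum_comm]
      exact Finset.sum_congr rfl fun b _ => by simp [mul_comm]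
    rw [P.histExp_congr π n this, histExp_sum]
    refine Finset.sum_congr rfl fun s _ => ?_
    rw [histExp_sum]
    refine Finset.sum_congr rfl fun b _ => ?_
    rw [histExp_const_mul, mul_comm]
  -- One step of `π'` and one step of `π` have the same effect on state-action functionals.
  have hstep : ∀ n, (∀ f : S n → ℝ,
      P.histExp (LatentPolicy.toPolicy π') n (fun h => f (h.1 (Fin.last n))) =
        P.histExp π n fun h => f (h.1 (Fin.last n))) → ∀ g : S n → A n → ℝ,
      P.histExp (LatentPolicy.toPolicy π') n (fun h => ∑ b,
        (LatentPolicy.toPolicy π' : Policy S X A) n h.1 h.2.1 h.2.2 b * g (h.1 (Fin.last n)) b) =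
        P.histExp π n fun h => ∑ b, π n h.1 h.2.1 h.2.2 b * g (h.1 (Fin.last n)) b := by
    intro n ih g
    rw [hj_sum]
    refine (ih fun s => ∑ b, π' n s b * g s b).trans ?_
    rw [P.histExp_last π n fun s => ∑ b, π' n s b * g s b]
    refine Finset.sum_congr rfl fun s _ => ?_
    rw [Finset.mul_sum]
    refine Finset.sum_congr rfl fun b _ => ?_
    rw [← mul_assoc, hπ']
  have hstate : ∀ n (f : S n → ℝ),
      P.histExp (LatentPolicy.toPolicy π') n (fun h => f (h.1 (Fin.last n))) =
        P.histExp π n fun h => f (h.1 (Fin.last n)) := by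
    intro n
    induction n with
    | zero => intro f; rw [histExp_zero, histExp_zero]
    | succ n ih =>
      intro f
      rw [histExp_succ, histExp_succ]
      simpa [histEquiv, ← Finset.sum_mul, PDist.sum_eq_one] using
        hstep n ih fun s b => ∑ s', P.trans n s b s' * f s'
  refine ⟨π', ?_⟩
  rw [value_eq_sum, value_eq_sum]
  exact Finset.sum_congr rfl fun i _ => hstep i (hstate i) (P.reward i)

theorem IsOptimalLatent.value_le [∀ h, Nonempty (A h)] {P : POMDP S X A} {πlat : LatentPolicy S A}
    (h : P.IsOptimalLatent πlat) (π : Policy S X A) :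
    P.value π ≤ P.value (LatentPolicy.toPolicy πlat) := by
  obtain ⟨π', hπ'⟩ := P.exists_latentPolicy_value_eq π
  exact hπ' ▸ h π'

end POMDP

/-! ### Bayes filters and the Bhattacharyya potential -/

theorem Real.sqrt_sum_le {ι : Type*} (t : Finset ι) (f : ι → ℝ) (hf : ∀ i, 0 ≤ f i) :
    √(∑ i ∈ t, f i) ≤ ∑ i ∈ t, √(f i) := by
  rw [Real.sqrt_le_left (Finset.sum_nonneg fun i _ => Real.sqrt_nonneg _)]
  calc ∑ i ∈ t, f i = ∑ i ∈ t, √(f i) ^ 2 :=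
        Finset.sum_congr rfl fun i _ => (Real.sq_sqrt (hf i)).symm
    _ ≤ _ := Finset.sum_sq_le_sq_sum_of_nonneg fun i _ => Real.sqrt_nonneg _

theorem Real.sqrt_mul_sqrt_le {x y : ℝ} (hx : 0 ≤ x) (hy : 0 ≤ y) : √x * √y ≤ (x + y) / 2 := by
  nlinarith [sq_nonneg (√x - √y), Real.sq_sqrt hx, Real.sq_sqrt hy]

theorem Real.mul_sqrt_div_le {x y : ℝ} (hx : 0 ≤ x) : x * √(y / x) ≤ √x * √y := by
  rcases hx.eq_or_lt with rfl | hx'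
  · simp
  · have h := Real.mul_self_sqrt hx
    have hpos := Real.sqrt_pos.2 hx'
    rw [Real.sqrt_div' _ hx]
    refine le_of_eq ?_
    nth_rewrite 1 [← h]
    field_simp

/-- The Bhattacharyya coefficient of two distributions that are `δ`-close to distributions with
disjoint supports is at most `2 √δ`. -/
theorem PDist.sum_sqrt_mul_sqrt_le {α : Type*} [Fintype α] {p q p' q' e f : PDist α} {δ : ℝ}
    (hδ : 0 < δ)
    (hd : Disjoint (Function.support (p' : α → ℝ)) (Function.support (q' : α → ℝ)))
    (hp : ∀ a, p a = (1 - δ) * p' a + δ * e a) (hq : ∀ a, q a = (1 - δ) * q' a + δ * f a) :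
    ∑ a, √(p a) * √(q a) ≤ 2 * √δ := by
  have hle : ∀ a, √(p a) * √(q a) ≤ √δ * ((e a + q a) / 2 + (p a + f a) / 2) := by
    intro a
    have h1 := p.nonneg a
    have h2 := q.nonneg a
    have h3 := e.nonneg a
    have h4 := f.nonneg a
    by_cases ha : p' a = 0
    · rw [show √(p a) = √δ * √(e a) by rw [hp, ha, mul_zero, zero_add, Real.sqrt_mul hδ.le],
        mul_assoc]
      refine mul_le_mul_of_nonneg_left ?_ (Real.sqrt_nonneg _)
      linarith [Real.sqrt_mul_sqrt_le h3 h2]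
    · have hb : q' a = 0 := by
        by_contra hb
        exact Set.disjoint_left.1 hd ha hb
      rw [show √(q a) = √δ * √(f a) by rw [hq, hb, mul_zero, zero_add, Real.sqrt_mul hδ.le],
        mul_left_comm]
      refine mul_le_mul_of_nonneg_left ?_ (Real.sqrt_nonneg _)
      linarith [Real.sqrt_mul_sqrt_le h1 h4]
  refine (Finset.sum_le_sum fun a _ => hle a).trans_eq ?_
  rw [← Finset.mul_sum, Finset.sum_add_distrib, ← Finset.sum_div, ← Finset.sum_div,
    Finset.sum_add_distrib, Finset.sum_add_distrib]
  simp only [PDist.sum_eq_one]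
  ring

/-- One step of a Bayes filter with deterministic transitions `f` and emissions `e` contracts the
square-root likelihood ratio potential in expectation. The states that `f` merges with the true
one drop out, and the other ones pay a Bhattacharyya coefficient. -/
theorem sum_sqrt_ratio_le {σ σ' ξ : Type*} [Fintype σ] [Fintype σ'] [Fintype ξ]
    [DecidableEq σ] [DecidableEq σ'] (F : σ → ℝ) (hF : ∀ s, 0 ≤ F s) (f : σ → σ')
    (e : σ' → PDist ξ) {κ c : ℝ} (hc : 0 < c) (hκ0 : 0 ≤ κ)
    (hκ : ∀ s s', s ≠ s' → ∑ x, √(e s x) * √(e s' x) ≤ κ) (s₀ : σ) (hs₀ : 0 < F s₀) :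
    ∑ x, e (f s₀) x * ∑ s' ∈ Finset.univ.erase (f s₀),
      √(c * (∑ s, F s * if s' = f s then 1 else 0) * e s' x /
        (c * (∑ s, F s * if f s₀ = f s then 1 else 0) * e (f s₀) x))
      ≤ κ * ∑ s ∈ Finset.univ.erase s₀, √(F s / F s₀) := by
  set M : σ' → ℝ := fun s' => ∑ s, F s * if s' = f s then 1 else 0 with hM
  have hMnn : ∀ s', 0 ≤ M s' := fun s' => Finset.sum_nonneg fun s _ =>
    mul_nonneg (hF s) (by split_ifs <;> simp)
  have hM₀ : F s₀ ≤ M (f s₀) := by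
    refine le_trans (by simp) (Finset.single_le_sum
      (f := fun s => F s * if f s₀ = f s then 1 else 0) (fun s _ => ?_) (Finset.mem_univ s₀))
    exact mul_nonneg (hF s) (by split_ifs <;> simp)
  have hratio : ∀ s', √(M s' / M (f s₀)) ≤ ∑ s, if s' = f s then √(F s / F s₀) else 0 := by
    intro s'
    calc √(M s' / M (f s₀)) ≤ √(M s' / F s₀) :=
          Real.sqrt_le_sqrt (div_le_div_of_nonneg_left (hMnn s') hs₀ hM₀)
      _ = √(∑ s, if s' = f s then F s / F s₀ else 0) := by
          rw [hM, Finset.sum_div]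
          congr 1
          refine Finset.sum_congr rfl fun s _ => ?_
          split_ifs <;> simp
      _ ≤ ∑ s, √(if s' = f s then F s / F s₀ else 0) := by
          refine Real.sqrt_sum_le _ _ fun s => ?_
          split_ifs
          exacts [div_nonneg (hF s) hs₀.le, le_rfl]
      _ = _ := by
          refine Finset.sum_congr rfl fun s _ => ?_
          split_ifs <;> simp
  have hterm : ∀ s' x, e (f s₀) x * √(c * M s' * e s' x / (c * M (f s₀) * e (f s₀) x)) ≤
      √(e (f s₀) x) * √(e s' x) * √(M s' / M (f s₀)) := by
    intro s' x
    have : c * M s' * e s' x / (c * M (f s₀) * e (f s₀) x) =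
        M s' / M (f s₀) * (e s' x / e (f s₀) x) := by
      rw [mul_assoc, mul_assoc, mul_div_mul_left _ _ hc.ne', mul_div_mul_comm]
    rw [this, Real.sqrt_mul (div_nonneg (hMnn _) (hMnn _)), mul_left_comm, mul_comm]
    exact mul_le_mul_of_nonneg_right (Real.mul_sqrt_div_le (PDist.nonneg _ _)) (Real.sqrt_nonneg _)
  calc _ ≤ ∑ x, ∑ s' ∈ Finset.univ.erase (f s₀),
        √(e (f s₀) x) * √(e s' x) * √(M s' / M (f s₀)) := by
        refine Finset.sum_le_sum fun x _ => ?_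
        rw [Finset.mul_sum]
        exact Finset.sum_le_sum fun s' _ => hterm s' x
    _ = ∑ s' ∈ Finset.univ.erase (f s₀),
        (∑ x, √(e (f s₀) x) * √(e s' x)) * √(M s' / M (f s₀)) := by
        rw [Finset.sum_comm]
        exact Finset.sum_congr rfl fun s' _ => (Finset.sum_mul _ _ _).symm
    _ ≤ ∑ s' ∈ Finset.univ.erase (f s₀), κ * ∑ s, if s' = f s then √(F s / F s₀) else 0 := by
        refine Finset.sum_le_sum fun s' hs' => ?_
        have hne : f s₀ ≠ s' := (Finset.ne_of_mem_erase hs').symm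
        exact mul_le_mul (hκ _ _ hne) (hratio s') (Real.sqrt_nonneg _) hκ0
    _ = κ * ∑ s, ∑ s' ∈ Finset.univ.erase (f s₀), if s' = f s then √(F s / F s₀) else 0 := by
        rw [← Finset.mul_sum, Finset.sum_comm]
    _ ≤ _ := by
        refine mul_le_mul_of_nonneg_left ?_ hκ0
        rw [← Finset.add_sum_erase _ _ (Finset.mem_univ s₀),
          Finset.sum_eq_zero fun s' hs' => if_neg (Finset.ne_of_mem_erase hs'), zero_add]
        refine Finset.sum_le_sum fun s _ => ?_
        rw [Finset.sum_ite_eq']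
        split_ifs
        exacts [le_rfl, Real.sqrt_nonneg _]

/-- The posterior probability of the wrong states is at most the sum of the square roots of their
likelihood ratios to the true state `s₀`: each probability is at most its own square root. -/
theorem sum_div_sum_le_sum_sqrt {σ : Type*} [Fintype σ] [DecidableEq σ] (w : σ → ℝ)
    (hw : ∀ s, 0 ≤ w s) (s₀ : σ) (hs₀ : 0 < w s₀) :
    ∑ s ∈ Finset.univ.erase s₀, w s / ∑ s, w s ≤ ∑ s ∈ Finset.univ.erase s₀, √(w s / w s₀) := by
  have hle : ∀ s, w s ≤ ∑ s, w s := fun s =>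
    Finset.single_le_sum (fun s _ => hw s) (Finset.mem_univ s)
  have hZ : 0 < ∑ s, w s := hs₀.trans_le (hle s₀)
  refine Finset.sum_le_sum fun s _ => ?_
  have h1 : w s / ∑ s, w s ≤ 1 := (div_le_one hZ).2 (hle s)
  have h0 : 0 ≤ w s / ∑ s, w s := div_nonneg (hw s) hZ.le
  refine Real.le_sqrt_of_sq_le ?_
  calc (w s / ∑ s, w s) ^ 2 ≤ w s / ∑ s, w s := by nlinarith
    _ ≤ _ := div_le_div_of_nonneg_left (hw s) hs₀ (hle s₀)

/-- When the prior is the true law, the square-root likelihood ratio potential is at most the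
number of states. -/
theorem sum_mul_sum_sqrt_ratio_le_card {σ : Type*} [Fintype σ] [DecidableEq σ] (D : σ → ℝ)
    (hD : ∀ s, 0 ≤ D s) (hD1 : ∑ s, D s = 1) :
    ∑ s, D s * ∑ s' ∈ Finset.univ.erase s, √(D s' / D s) ≤ Fintype.card σ := by
  calc ∑ s, D s * ∑ s' ∈ Finset.univ.erase s, √(D s' / D s)
      ≤ ∑ s, ∑ s', (D s + D s') / 2 := by
        refine Finset.sum_le_sum fun s _ => ?_
        rw [Finset.mul_sum]
        refine le_trans (Finset.sum_le_univ_sum_of_nonneg fun s' =>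
          mul_nonneg (hD s) (Real.sqrt_nonneg _)) (Finset.sum_le_sum fun s' _ => ?_)
        exact (Real.mul_sqrt_div_le (hD s)).trans (Real.sqrt_mul_sqrt_le (hD s) (hD s'))
    _ = Fintype.card σ := by
        simp only [← Finset.sum_div, Finset.sum_add_distrib, hD1, Finset.sum_const,
          Finset.card_univ, nsmul_eq_mul, ← Finset.mul_sum]
        ring

namespace POMDP

variable {S X A : ℕ → Type*}
  [∀ h, Fintype (S h)] [∀ h, Fintype (X h)] [∀ h, Fintype (A h)]

open scoped Classical in
/-- The part of the Bayes filter for the windows of step `t` that is known at step `n ≤ t`: the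
probability, under the policy `ρ`, that the latent state of step `n` is `s` and that the entries
before step `n` of the windows of step `t`, including the observation of step `n`, are those of
`x₀` and `a₀`. -/
def filterWeight (P : POMDP S X A) (ρ : Policy S X A) (L t n : ℕ) (x₀ : ∀ i : Fin (n + 1), X i)
    (a₀ : ∀ i : Fin n, A i) (s : S n) : ℝ :=
  P.histExp ρ n fun h =>
    if ((∀ i : Fin (n + 1), t < i + L → h.2.1 i = x₀ i) ∧
      ∀ i : Fin n, t ≤ i + L → h.2.2 i = a₀ i) ∧ h.1 (Fin.last n) = s then 1 else 0

theorem filterWeight_nonneg (P : POMDP S X A) (ρ : Policy S X A) (L t n : ℕ)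
    (x₀ : ∀ i : Fin (n + 1), X i) (a₀ : ∀ i : Fin n, A i) (s : S n) :
    0 ≤ P.filterWeight ρ L t n x₀ a₀ s :=
  P.histExp_nonneg ρ n fun h => by split_ifs <;> simp

theorem filterWeight_self (P : POMDP S X A) (ρ : Policy S X A) (L t : ℕ)
    (x₀ : ∀ i : Fin (t + 1), X i) (a₀ : ∀ i : Fin t, A i) (s : S t) :
    P.filterWeight ρ L t t x₀ a₀ s =
      P.windowWeight ρ L t (obsWindow L t x₀) (actWindow L t a₀) s := by
  refine P.histExp_congr ρ t fun h => ?_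
  congr 1
  refine propext (and_congr_left fun _ => and_congr ?_ ?_)
  · exact ⟨fun H => funext fun i => H ⟨i.1, Nat.lt_succ_of_le i.2.1⟩ i.2.2,
      fun H i hi => congrFun H ⟨i.1, Nat.le_of_lt_succ i.2, hi⟩⟩
  · exact ⟨fun H => funext fun i => H ⟨i.1, i.2.1⟩ i.2.2,
      fun H i hi => congrFun H ⟨i.1, i.2, hi⟩⟩

theorem filterWeight_of_add_le (P : POMDP S X A) (ρ : Policy S X A) (L t n : ℕ) (hn : n + L ≤ t)
    (x₀ : ∀ i : Fin (n + 1), X i) (a₀ : ∀ i : Fin n, A i) (s : S n) :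
    P.filterWeight ρ L t n x₀ a₀ s = P.stateLaw ρ n s := by
  refine P.histExp_congr ρ n fun h => ?_
  congr 1
  refine propext (and_iff_right ⟨fun i hi => ?_, fun i hi => ?_⟩) <;> omega

theorem histLaw_le_filterWeight (P : POMDP S X A) (ρ : Policy S X A) (L t n : ℕ)
    (h : Hist S X A n) :
    P.histLaw ρ n h ≤ P.filterWeight ρ L t n h.2.1 h.2.2 (h.1 (Fin.last n)) := by
  classical
  rw [filterWeight, histExp]
  refine le_trans (by simp) (Finset.single_le_sum (fun k _ => ?_) (Finset.mem_univ h))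
  refine mul_nonneg (P.histLaw_nonneg ρ n k) ?_
  split_ifs <;> simp

/-- The Bayes filter: prediction through the latent transition, then correction by the emission
probability. The action contributes only a constant, since it does not depend on the history. -/
theorem filterWeight_succ (P : POMDP S X A) (ρ : Policy S X A) (L t n : ℕ) (hn : t ≤ n + L)
    (p : PDist (A n)) (hρ : ∀ s x a, ρ n s x a = p) (x₀ : ∀ i : Fin (n + 1), X i)
    (a₀ : ∀ i : Fin n, A i) (x : X (n + 1)) (b : A n) (s : S (n + 1)) :
    P.filterWeight ρ L t (n + 1) (extend x₀ x) (extend a₀ b) s =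
      p b * (∑ s', P.filterWeight ρ L t n x₀ a₀ s' * P.trans n s' b s) * P.emit (n + 1) s x := by
  classical
  have hmatch : ∀ (h : Hist S X A n) (b' : A n) (s' : S (n + 1)) (x' : X (n + 1)),
      (((∀ i : Fin (n + 1 + 1), t < i + L → (histEquiv n (h, b', s', x')).2.1 i = extend x₀ x i) ∧
      ∀ i : Fin (n + 1), t ≤ i + L → (histEquiv n (h, b', s', x')).2.2 i = extend a₀ b i) ∧
        (histEquiv n (h, b', s', x')).1 (Fin.last (n + 1)) = s) ↔
      ((∀ i : Fin (n + 1), t < i + L → h.2.1 i = x₀ i) ∧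
        ∀ i : Fin n, t ≤ i + L → h.2.2 i = a₀ i) ∧ b' = b ∧ s' = s ∧ x' = x := by
    intro h b' s' x'
    rw [Fin.forall_fin_succ' (P := fun i : Fin (n + 1 + 1) => t < i + L →
        (histEquiv n (h, b', s', x')).2.1 i = extend x₀ x i),
      Fin.forall_fin_succ' (P := fun i : Fin (n + 1) => t ≤ i + L →
        (histEquiv n (h, b', s', x')).2.2 i = extend a₀ b i)]
    have h1 : t < n + 1 + L := by omega
    simp only [histEquiv, Equiv.coe_fn_mk, extend_castSucc, extend_last, Fin.val_castSucc,
      Fin.val_last, h1, hn, forall_true_left]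
    tauto
  rw [filterWeight, histExp_succ]
  simp only [hmatch, hρ]
  have hstep : ∀ h : Hist S X A n, (∑ b', p b' * ∑ s', P.trans n (h.1 (Fin.last n)) b' s' *
      ∑ x', P.emit (n + 1) s' x' *
        if ((∀ i : Fin (n + 1), t < i + L → h.2.1 i = x₀ i) ∧
          ∀ i : Fin n, t ≤ i + L → h.2.2 i = a₀ i) ∧ b' = b ∧ s' = s ∧ x' = x then (1 : ℝ) else 0) =
      ∑ s', (p b * P.trans n s' b s * P.emit (n + 1) s x) *
        if ((∀ i : Fin (n + 1), t < i + L → h.2.1 i = x₀ i) ∧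
          ∀ i : Fin n, t ≤ i + L → h.2.2 i = a₀ i) ∧ h.1 (Fin.last n) = s' then 1 else 0 := by
    intro h
    by_cases hm : (∀ i : Fin (n + 1), t < i + L → h.2.1 i = x₀ i) ∧
          ∀ i : Fin n, t ≤ i + L → h.2.2 i = a₀ i
    · simp only [eq_true hm, true_and]
      simp only [ite_and, mul_ite, mul_one, mul_zero,
        Finset.sum_ite_eq', Finset.sum_ite_eq, Finset.mem_univ, if_true, Finset.sum_ite_irrel,
        Finset.sum_const_zero]
      ring
    · simp only [hm, false_and, if_false, mul_zero, Finset.sum_const_zero]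
  rw [P.histExp_congr ρ n hstep, histExp_sum, Finset.mul_sum, Finset.sum_mul]
  refine Finset.sum_congr rfl fun s' _ => ?_
  rw [histExp_const_mul, ← filterWeight]
  ring

end POMDP

/-! ### Steps with a full window -/

section RollIn

variable {S X A : ℕ → Type*} [∀ h, Fintype (A h)] [∀ h, Nonempty (A h)]

theorem rollIn_of_lt {L : ℕ} (π : LStepPolicy X A L) {t i : ℕ} (hi : i + L < t) :
    (rollIn π t : Policy S X A) i = LStepPolicy.toPolicy π i := by
  funext s x a
  simp [rollIn, hi]

theorem rollIn_of_le {L : ℕ} (π : LStepPolicy X A L) {t i : ℕ} (hi : t ≤ i + L)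
    (s : ∀ j : Fin (i + 1), S j) (x : ∀ j : Fin (i + 1), X j) (a : ∀ j : Fin i, A j) :
    rollIn π t i s x a = uniformDist (A i) := by
  simp [rollIn, hi.not_gt]

theorem rollIn_pos {L : ℕ} (π : LStepPolicy X A L) (t i : ℕ)
    (s : ∀ j : Fin (i + 1), S j) (x : ∀ j : Fin (i + 1), X j) (a : ∀ j : Fin i, A j) (b : A i)
    (hb : 0 < LStepPolicy.toPolicy π i s x a b) : 0 < rollIn π t i s x a b := by
  rcases lt_or_ge (i + L) t with hi | hi
  · rwa [rollIn_of_lt π hi]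
  · rw [rollIn_of_le π hi]
    exact uniformDist_pos _ b

end RollIn

namespace POMDP

variable {S X A : ℕ → Type*}
  [∀ h, Fintype (S h)] [∀ h, Fintype (X h)] [∀ h, Fintype (A h)]

theorem histLaw_pos_of_pos (P : POMDP S X A) {π ρ : Policy S X A}
    (hπρ : ∀ i s x a b, 0 < π i s x a b → 0 < ρ i s x a b) (n : ℕ) (h : Hist S X A n)
    (hh : 0 < P.histLaw π n h) : 0 < P.histLaw ρ n h := by
  have key : ∀ n (τ : Traj S X A n), 0 < P.law π n τ → 0 < P.law ρ n τ := by
    intro n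
    induction n with
    | zero => exact fun _ _ => zero_lt_one
    | succ n ih =>
      intro τ hτ
      rw [law_succ] at hτ ⊢
      have h1 := pos_of_mul_pos_left hτ (PDist.nonneg _ _)
      have h2 := pos_of_mul_pos_right hτ (P.histLaw_nonneg π n _)
      rw [histLaw] at h1 ⊢
      have h3 := pos_of_mul_pos_left h1 (PDist.nonneg _ _)
      exact mul_pos (mul_pos (mul_pos (ih _ (pos_of_mul_pos_left h3 (PDist.nonneg _ _)))
        (pos_of_mul_pos_right h3 (P.law_nonneg π n _)))
        (pos_of_mul_pos_right h1 (mul_nonneg (P.law_nonneg π n _) (PDist.nonneg _ _))))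
        (hπρ _ _ _ _ _ h2)
  rw [histLaw] at hh ⊢
  have h3 := pos_of_mul_pos_left hh (PDist.nonneg _ _)
  exact mul_pos (mul_pos (key n _ (pos_of_mul_pos_left h3 (PDist.nonneg _ _)))
    (pos_of_mul_pos_right h3 (P.law_nonneg π n _)))
    (pos_of_mul_pos_right hh (mul_nonneg (P.law_nonneg π n _) (PDist.nonneg _ _)))

open scoped Classical in
/-- The probability that a state drawn from the posterior given the windows of step `t`, under the
policy `ρ`, differs from the current latent state. -/
def wrongWeight (P : POMDP S X A) (ρ : Policy S X A) (L t : ℕ) (h : Hist S X A t) : ℝ :=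
  ∑ s ∈ Finset.univ.erase (h.1 (Fin.last t)),
    P.windowWeight ρ L t (obsWindow L t h.2.1) (actWindow L t h.2.2) s /
      ∑ s, P.windowWeight ρ L t (obsWindow L t h.2.1) (actWindow L t h.2.2) s

/-- The output of the Forward algorithm differs from the expert only as far as the posterior it
uses gives weight to wrong latent states. -/
theorem IsForwardOutput.tvDist_trajLaw_le [∀ h, Nonempty (A h)] {P : POMDP S X A}
    {πlat : LatentPolicy S A} {L : ℕ} {π : LStepPolicy X A L} (hπ : P.IsForwardOutput πlat π) :
    tvDist (P.trajLaw (LatentPolicy.toPolicy πlat)) (P.trajLaw (LStepPolicy.toPolicy π)) ≤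
      ∑ t ∈ Finset.range P.horizon,
        P.histExp (LStepPolicy.toPolicy π) t (P.wrongWeight (rollIn π t) L t) := by
  classical
  refine (P.tvDist_law_le _ _ _).trans (Finset.sum_le_sum fun t ht => ?_)
  refine P.histExp_mono _ t fun h hh => ?_
  have hpos := (P.histLaw_pos_of_pos (rollIn_pos π t) t h hh).trans_le
    (P.histLaw_le_windowWeight _ L t h)
  have hW := P.windowWeight_nonneg (rollIn π t) L t (obsWindow L t h.2.1) (actWindow L t h.2.2)
  refine (PDist.tvDist_mixture_le (πlat t) (π t (obsWindow L t h.2.1) (actWindow L t h.2.2)) _ hW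
    (hpos.trans_le (Finset.single_le_sum (fun s _ => hW s) (Finset.mem_univ _)))
    (P.maximizer_eq_posterior _ πlat (π t) (hπ t (Finset.mem_range.1 ht)) _ _)
    (h.1 (Fin.last t))).trans_eq ?_
  rw [wrongWeight]
  congr!

theorem trans_eq_ite [∀ h, DecidableEq (S h)] {P : POMDP S X A} (hP : P.DeterministicTransitions)
    {n : ℕ} (hn : n + 1 < P.horizon) :
    ∃ f : S n → A n → S (n + 1), ∀ s a s', P.trans n s a s' = if s' = f s a then 1 else 0 := by
  choose f hf using hP n hn
  refine ⟨f, fun s a s' => ?_⟩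
  split_ifs with h
  · rw [h, hf]
  · have h1 := PDist.sum_eq_one (P.trans n s a)
    rw [← Finset.add_sum_erase _ _ (Finset.mem_univ (f s a)), hf, add_eq_left,
      Finset.sum_eq_zero_iff_of_nonneg fun _ _ => PDist.nonneg _ _] at h1
    exact h1 s' (by simpa using h)

/-- After a full window, the posterior has forgotten its prior: the expected weight of the wrong
states decays exponentially in the window length, from the number of states on. -/
theorem histExp_wrongWeight_le_of_le [∀ h, Nonempty (A h)] {P : POMDP S X A} {δ : ℝ}
    (hB : P.IsPerturbedBlockMDP δ) (hD : P.DeterministicTransitions) {L : ℕ}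
    (π : LStepPolicy X A L) {T : ℕ} (ht : T + L < P.horizon) :
    P.histExp (LStepPolicy.toPolicy π) (T + L) (P.wrongWeight (rollIn π (T + L)) L (T + L)) ≤
      (2 * √δ) ^ L * Fintype.card (S T) := by
  classical
  set t := T + L with htdef
  set ρ : Policy S X A := rollIn π t with hρ
  have hδ := hB.1
  -- The square-root likelihood ratio potential.
  let Ψ : ∀ n, Hist S X A n → ℝ := fun n h => ∑ s ∈ Finset.univ.erase (h.1 (Fin.last n)),
    √(P.filterWeight ρ L t n h.2.1 h.2.2 s / P.filterWeight ρ L t n h.2.1 h.2.2 (h.1 (Fin.last n)))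
  have hFpos : ∀ n (h : Hist S X A n), 0 < P.histLaw (LStepPolicy.toPolicy π) n h →
      0 < P.filterWeight ρ L t n h.2.1 h.2.2 (h.1 (Fin.last n)) := fun n h hh =>
    (P.histLaw_pos_of_pos (rollIn_pos π t) n h hh).trans_le (P.histLaw_le_filterWeight _ L t n h)
  have hprior : ∀ s, P.stateLaw ρ T s = P.stateLaw (LStepPolicy.toPolicy π) T s := by
    intro s
    rw [stateLaw, stateLaw, histExp, histExp]
    refine Finset.sum_congr rfl fun h _ => ?_
    rw [P.histLaw_congr T (fun i hi => rollIn_of_lt π (by omega)) h]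
  have hbase : P.histExp (LStepPolicy.toPolicy π) T (Ψ T) ≤ Fintype.card (S T) := by
    refine le_trans (le_of_eq ?_) (sum_mul_sum_sqrt_ratio_le_card _ (P.stateLaw_nonneg ρ T)
      (P.sum_stateLaw ρ T))
    have h1 := P.histExp_last (LStepPolicy.toPolicy π) T fun s =>
      ∑ s' ∈ Finset.univ.erase s, √(P.stateLaw ρ T s' / P.stateLaw ρ T s)
    simp only [← hprior] at h1
    rw [← h1]
    refine P.histExp_congr _ T fun h => ?_
    simp only [Ψ, P.filterWeight_of_add_le ρ L t T le_rfl]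
    congr!
  have hstep : ∀ n, T ≤ n → n < t → P.histExp (LStepPolicy.toPolicy π) (n + 1) (Ψ (n + 1)) ≤
      2 * √δ * P.histExp (LStepPolicy.toPolicy π) n (Ψ n) := by
    intro n hTn hnt
    obtain ⟨f, hf⟩ := trans_eq_ite hD (n := n) (by omega)
    obtain ⟨O', E, hdisj, hemit⟩ := hB.2 (n + 1) (by omega)
    rw [histExp_succ, ← histExp_const_mul]
    refine P.histExp_mono _ n fun h hh => ?_
    refine le_trans (Finset.sum_le_sum fun b _ => mul_le_mul_of_nonneg_left ?_
      (PDist.nonneg _ b)) (le_of_eq (by rw [← Finset.sum_mul, PDist.sum_eq_one, one_mul]))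
    simp only [hf, ite_mul, one_mul, zero_mul, Finset.sum_ite_eq', Finset.mem_univ, if_true]
    have := sum_sqrt_ratio_le (P.filterWeight ρ L t n h.2.1 h.2.2)
      (P.filterWeight_nonneg ρ L t n h.2.1 h.2.2) (fun s => f s b) (P.emit (n + 1))
      (uniformDist_pos (A n) b) (κ := 2 * √δ) (by positivity)
      (fun s s' hs => PDist.sum_sqrt_mul_sqrt_le hδ (hdisj s s' hs) (hemit s) (hemit s'))
      (h.1 (Fin.last n)) (hFpos n h hh)
    refine le_trans (le_of_eq ?_) this
    refine Finset.sum_congr rfl fun x _ => ?_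
    simp only [Ψ, histEquiv, Equiv.coe_fn_mk, extend_last]
    congr 1
    refine Finset.sum_congr rfl fun s' _ => ?_
    rw [P.filterWeight_succ ρ L t n (by omega) _ (fun s x a => rollIn_of_le π (by omega) s x a),
      P.filterWeight_succ ρ L t n (by omega) _ (fun s x a => rollIn_of_le π (by omega) s x a)]
    simp only [hf]
  have hiter : ∀ k ≤ L, P.histExp (LStepPolicy.toPolicy π) (T + k) (Ψ (T + k)) ≤
      (2 * √δ) ^ k * Fintype.card (S T) := by
    intro k
    induction k with
    | zero => intro _; simpa using hbase
    | succ k ih =>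
      intro hk
      refine (hstep (T + k) (by omega) (by omega)).trans ?_
      rw [pow_succ', mul_assoc (2 * √δ)]
      exact mul_le_mul_of_nonneg_left (ih (by omega)) (by positivity)
  refine le_trans (P.histExp_mono _ t fun h hh => ?_) (hiter L le_rfl)
  have hpos := hFpos t h hh
  rw [filterWeight_self] at hpos
  rw [wrongWeight]
  refine (sum_div_sum_le_sum_sqrt _ (P.windowWeight_nonneg ρ L t _ _) _ hpos).trans_eq ?_
  simp only [Ψ, t, filterWeight_self]
  congr!

end POMDP

/-! ### Steps before the window is full -/

/-- If at most one state lies outside `B`, the posterior weight of the wrong states is on average at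
most twice the probability of `B`. -/
theorem sum_mul_wrong_le {σ : Type*} [Fintype σ] [DecidableEq σ] (w : σ → ℝ) (hw : ∀ s, 0 ≤ w s)
    (B : σ → Prop) [DecidablePred B] (hB : ∀ s s', ¬ B s → ¬ B s' → s = s') :
    ∑ s, w s * ∑ s' ∈ Finset.univ.erase s, w s' / ∑ s', w s' ≤
      2 * ∑ s, w s * if B s then 1 else 0 := by
  set Z := ∑ s, w s with hZ
  have hZ0 : 0 ≤ Z := Finset.sum_nonneg fun s _ => hw s
  have hle : ∀ s, w s / Z ≤ 1 := fun s => div_le_one_of_le₀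
    (Finset.single_le_sum (fun s _ => hw s) (Finset.mem_univ s)) hZ0
  have hle' : ∀ s, ∑ s' ∈ Finset.univ.erase s, w s' / Z ≤ 1 := by
    intro s
    rw [← Finset.sum_div]
    exact div_le_one_of_le₀ (Finset.sum_le_sum_of_subset_of_nonneg (Finset.erase_subset _ _)
      fun s _ _ => hw s) hZ0
  by_cases h : ∃ s₀, ¬ B s₀
  · obtain ⟨s₀, hs₀⟩ := h
    have hBs : ∀ s ∈ Finset.univ.erase s₀, (w s * if B s then 1 else 0) = w s := by
      intro s hs
      rw [if_pos, mul_one]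
      by_contra hs'
      exact Finset.ne_of_mem_erase hs (hB s s₀ hs' hs₀)
    rw [← Finset.add_sum_erase _ _ (Finset.mem_univ s₀),
      ← Finset.add_sum_erase _ (fun s => w s * if B s then 1 else 0) (Finset.mem_univ s₀),
      Finset.sum_congr rfl hBs, if_neg hs₀, mul_zero, zero_add, two_mul]
    refine add_le_add ?_ (Finset.sum_le_sum fun s _ => mul_le_of_le_one_right (hw s) (hle' s))
    rw [Finset.mul_sum]
    refine Finset.sum_le_sum fun s _ => ?_
    rw [mul_div_left_comm]
    exact mul_le_of_le_one_right (hw s) (hle s₀)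
  · push Not at h
    simp only [h, if_true, mul_one, ← hZ]
    calc _ ≤ ∑ s, w s := Finset.sum_le_sum fun s _ => mul_le_of_le_one_right (hw s) (hle' s)
      _ ≤ _ := by rw [← hZ]; linarith

section MatchCount

variable {S X A : ℕ → Type*} [∀ h, Fintype (S h)]

open scoped Classical in
/-- The number of observations so far that are decoded by `D` to a state on some path that ends in
the given state, where `f` says which transitions are possible. -/
def matchCount (f : ∀ n, S n → A n → S (n + 1) → Prop) (D : ∀ n, S n → X n → Prop) :
    ∀ n, (∀ i : Fin (n + 1), X i) → (∀ i : Fin n, A i) → S n → ℕ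
  | 0, x, _, s => if D 0 s (x 0) then 1 else 0
  | n + 1, x, a, s =>
      (∑ s', if f n s' (a (Fin.last n)) s then
        matchCount f D n (fun i => x i.castSucc) (fun i => a i.castSucc) s' else 0) +
      if D (n + 1) s (x (Fin.last (n + 1))) then 1 else 0

/-- An observation is decoded to at most one state, and transitions merge paths without splitting
them, so each observation is counted for at most one state. -/
theorem sum_matchCount_le (f : ∀ n, S n → A n → S (n + 1) → Prop) (D : ∀ n, S n → X n → Prop)
    (hf : ∀ n s a s' s'', f n s a s' → f n s a s'' → s' = s'')
    (hD : ∀ n s s' x, D n s x → D n s' x → s = s') :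
    ∀ n (x : ∀ i : Fin (n + 1), X i) (a : ∀ i : Fin n, A i),
      ∑ s, matchCount f D n x a s ≤ n + 1 := by
  classical
  have hone : ∀ n x, ∑ s, (if D n s x then 1 else 0) ≤ 1 := by
    intro n x
    rw [Finset.sum_boole, Nat.cast_id, Finset.card_le_one]
    intro s hs s' hs'
    exact hD n s s' x (by simpa using hs) (by simpa using hs')
  intro n
  induction n with
  | zero => intro x a; exact hone 0 _
  | succ n ih =>
    intro x a
    simp only [matchCount, Finset.sum_add_distrib]
    refine add_le_add (le_trans ?_ (ih (fun i => x i.castSucc) fun i => a i.castSucc)) (hone _ _)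
    rw [Finset.sum_comm]
    refine Finset.sum_le_sum fun s _ => ?_
    rw [← Finset.sum_filter, Finset.sum_const, smul_eq_mul]
    refine mul_le_of_le_one_left (Nat.zero_le _) (Finset.card_le_one.2 fun s' hs' s'' hs'' => ?_)
    exact hf n s _ s' s'' (by simpa using hs') (by simpa using hs'')

open scoped Classical in
theorem matchCount_extend_ge (f : ∀ n, S n → A n → S (n + 1) → Prop) (D : ∀ n, S n → X n → Prop)
    (n : ℕ) (x : ∀ i : Fin (n + 1), X i) (a : ∀ i : Fin n, A i)
    (y : X (n + 1)) (b : A n) (s : S n) (s' : S (n + 1)) (hs : f n s b s') :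
    matchCount f D n x a s + (if D (n + 1) s' y then 1 else 0) ≤
      matchCount f D (n + 1) (extend x y) (extend a b) s' := by
  simp only [matchCount, extend_castSucc, extend_last]
  refine add_le_add ?_ le_rfl
  refine le_trans (by simp [hs]) (Finset.single_le_sum (f := fun s₁ => if f n s₁ b s' then
    matchCount f D n x a s₁ else 0) (fun _ _ => Nat.zero_le _) (Finset.mem_univ s))

end MatchCount

namespace POMDP

variable {S X A : ℕ → Type*}
  [∀ h, Fintype (S h)] [∀ h, Fintype (X h)] [∀ h, Fintype (A h)]

open scoped Classical in
/-- A perturbed Block MDP has a decoder that errs with probability at most `δ`. The decoder is given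
as a relation, which relates an observation to at most one state. -/
theorem IsPerturbedBlockMDP.exists_decoder {P : POMDP S X A} {δ : ℝ}
    (hB : P.IsPerturbedBlockMDP δ) :
    ∃ D : ∀ n, S n → X n → Prop, (∀ n s s' x, D n s x → D n s' x → s = s') ∧
      ∀ n, n < P.horizon → ∀ s,
        ∑ x, P.emit n s x * (if D n s x then 0 else 1) ≤ δ := by
  have hδ0 := hB.1
  choose O' E hdisj hemit using hB.2
  refine ⟨fun n s x => ∃ hn : n < P.horizon, O' n hn s x ≠ 0, ?_, ?_⟩
  · rintro n s s' x ⟨hn, hx⟩ ⟨_, hx'⟩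
    by_contra hne
    exact Set.disjoint_left.1 (hdisj n hn s s' hne) hx hx'
  · intro n hn s
    calc _ ≤ ∑ x, δ * E n hn s x := by
          refine Finset.sum_le_sum fun x _ => ?_
          have hE := mul_nonneg hδ0.le (PDist.nonneg (E n hn s) x)
          split_ifs with h
          · simpa using hE
          · have : O' n hn s x = 0 := by
              by_contra h0
              exact h ⟨hn, h0⟩
            rw [hemit n hn, this]
            simp
      _ = δ := by rw [← Finset.mul_sum, PDist.sum_eq_one, mul_one]

open scoped Classical in
/-- The Chernoff bound for the number of decoding errors along the latent trajectory, in terms of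
the exponential moment of the number of matches. -/
theorem histExp_pow_matchCount_le {P : POMDP S X A} {δ : ℝ} (hδ0 : 0 < δ)
    (hδ : δ ≤ 1) (hP : P.DeterministicTransitions) (D : ∀ n, S n → X n → Prop)
    (hD : ∀ n, n < P.horizon → ∀ s, ∑ x, P.emit n s x * (if D n s x then 0 else 1) ≤ δ)
    (π : Policy S X A) (n : ℕ) (hn : n < P.horizon) :
    P.histExp π n (fun h => δ ^ matchCount (fun n s a s' => P.trans n s a s' = 1) D n
      h.2.1 h.2.2 (h.1 (Fin.last n))) ≤ (2 * δ) ^ (n + 1) := by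
  classical
  have hstep : ∀ n, n < P.horizon → ∀ s,
      ∑ x, P.emit n s x * δ ^ (if D n s x then 1 else 0) ≤ 2 * δ := by
    intro n hn s
    calc _ ≤ ∑ x, (P.emit n s x * δ + P.emit n s x * if D n s x then 0 else 1) := by
          refine Finset.sum_le_sum fun x _ => ?_
          have := PDist.nonneg (P.emit n s) x
          split_ifs
          · simp
          · simp only [pow_zero, mul_one]
            nlinarith
      _ ≤ 2 * δ := by
          rw [Finset.sum_add_distrib, ← Finset.sum_mul, PDist.sum_eq_one]
          linarith [hD n hn s]
  induction n with
  | zero =>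
    rw [histExp_zero]
    calc _ ≤ ∑ s, P.init s * (2 * δ) := by
          refine Finset.sum_le_sum fun s _ => mul_le_mul_of_nonneg_left ?_ (PDist.nonneg _ _)
          refine le_trans (le_of_eq ?_) (hstep 0 hn s)
          refine Finset.sum_congr rfl fun x _ => ?_
          simp only [matchCount, histZeroEquiv, Equiv.coe_fn_mk, extend_last, extend_zero]
      _ = _ := by rw [← Finset.sum_mul, PDist.sum_eq_one]; ring
  | succ n ih =>
    obtain ⟨f, hf⟩ := trans_eq_ite hP hn
    rw [histExp_succ, pow_succ, mul_comm]
    refine le_trans ?_ (mul_le_mul_of_nonneg_left (ih (by omega)) (by positivity))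
    rw [← histExp_const_mul]
    refine P.histExp_mono π n fun h _ => ?_
    refine le_trans (Finset.sum_le_sum fun b _ => mul_le_mul_of_nonneg_left ?_
      (PDist.nonneg _ b)) (le_of_eq (by rw [← Finset.sum_mul, PDist.sum_eq_one, one_mul]))
    set s := h.1 (Fin.last n) with hs
    have hone : P.trans n s b (f s b) = 1 := by rw [hf, if_pos rfl]
    have hdet : ∀ g : S (n + 1) → ℝ, ∑ s', P.trans n s b s' * g s' = g (f s b) := by
      intro g
      simp only [hf, ite_mul, one_mul, zero_mul, Finset.sum_ite_eq', Finset.mem_univ, if_true]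
    rw [hdet]
    calc _ ≤ ∑ x, P.emit (n + 1) (f s b) x * δ ^ (if D (n + 1) (f s b) x then 1 else 0) *
            δ ^ matchCount (fun n s a s' => P.trans n s a s' = 1) D n h.2.1 h.2.2 s := by
          refine Finset.sum_le_sum fun x _ => ?_
          rw [mul_assoc, ← pow_add]
          refine mul_le_mul_of_nonneg_left ?_ (PDist.nonneg _ _)
          refine pow_le_pow_of_le_one hδ0.le hδ ?_
          rw [add_comm (ite _ _ _)]
          have := matchCount_extend_ge (fun n s a s' => P.trans n s a s' = 1) D n h.2.1 h.2.2 x b s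
            (f s b) hone
          simpa only [histEquiv, Equiv.coe_fn_mk, extend_last] using this
      _ ≤ _ := by
          rw [← Finset.sum_mul]
          exact mul_le_mul_of_nonneg_right (hstep (n + 1) hn _) (by positivity)

open scoped Classical in
/-- The total probability of the state sequences that end in `s`, with given observations and
actions. -/
def endWeight (P : POMDP S X A) (ρ : Policy S X A) (t : ℕ) (x : ∀ i : Fin (t + 1), X i)
    (a : ∀ i : Fin t, A i) (s : S t) : ℝ :=
  ∑ ss : ∀ i : Fin (t + 1), S i, if ss (Fin.last t) = s then P.histLaw ρ t (ss, x, a) else 0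

theorem windowWeight_eq_endWeight (P : POMDP S X A) (ρ : Policy S X A) {L t : ℕ} (ht : t < L)
    (x : ∀ i : Fin (t + 1), X i) (a : ∀ i : Fin t, A i) (s : S t) :
    P.windowWeight ρ L t (obsWindow L t x) (actWindow L t a) s = P.endWeight ρ t x a s := by
  classical
  have hx : ∀ x' : ∀ i : Fin (t + 1), X i, obsWindow L t x' = obsWindow L t x ↔ x' = x :=
    fun x' => ⟨fun H => funext fun i => congrFun H ⟨i.1, by omega⟩, fun H => H ▸ rfl⟩
  have ha : ∀ a' : ∀ i : Fin t, A i, actWindow L t a' = actWindow L t a ↔ a' = a :=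
    fun a' => ⟨fun H => funext fun i => congrFun H ⟨i.1, by omega⟩, fun H => H ▸ rfl⟩
  rw [windowWeight, histExp, Fintype.sum_prod_type, endWeight]
  refine Finset.sum_congr rfl fun ss _ => ?_
  simp only [hx, ha]
  rw [Fintype.sum_eq_single (x, a)]
  · simp
  · rintro ⟨x', a'⟩ hne
    rw [if_neg, mul_zero]
    rintro ⟨⟨rfl, rfl⟩, -⟩
    exact hne rfl

/-- If `π` does not look at the latent states and `ρ` draws each action independently of the
history, then their likelihood ratio is a function of the observations and actions alone. -/
theorem exists_histLaw_eq_mul (P : POMDP S X A) {π ρ : Policy S X A} (n : ℕ)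
    (hπ : ∀ i s s' x a, π i s x a = π i s' x a)
    (hρ : ∀ i < n, ∃ p : PDist (A i), (∀ b, 0 < p b) ∧ ∀ s x a, ρ i s x a = p) :
    ∃ r : (∀ i : Fin (n + 1), X i) → (∀ i : Fin n, A i) → ℝ, (∀ x a, 0 ≤ r x a) ∧
      ∀ s x a, P.histLaw π n (s, x, a) = r x a * P.histLaw ρ n (s, x, a) := by
  have key : ∀ m ≤ n, ∃ r : (∀ i : Fin m, X i) → (∀ i : Fin m, A i) → ℝ, (∀ x a, 0 ≤ r x a) ∧
      ∀ s x a, P.law π m (s, x, a) = r x a * P.law ρ m (s, x, a) := by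
    intro m
    induction m with
    | zero => exact fun _ => ⟨fun _ _ => 1, fun _ _ => zero_le_one, fun _ _ _ => (one_mul _).symm⟩
    | succ m ih =>
      intro hm
      obtain ⟨r, hr0, hr⟩ := ih (by omega)
      obtain ⟨p, hp, hρm⟩ := hρ m (by omega)
      rcases isEmpty_or_nonempty (∀ i : Fin (m + 1), S i) with hS | ⟨⟨s₀⟩⟩
      · exact ⟨fun _ _ => 0, fun _ _ => le_rfl, fun s => hS.elim s⟩
      refine ⟨fun x a => r (fun i => x i.castSucc) (fun i => a i.castSucc) *
        (π m s₀ x (fun i => a i.castSucc) (a (Fin.last m)) / p (a (Fin.last m))), fun x a =>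
        mul_nonneg (hr0 _ _) (div_nonneg (PDist.nonneg _ _) (PDist.nonneg _ _)), fun s x a => ?_⟩
      have := (hp (a (Fin.last m))).ne'
      rw [law_succ, law_succ, histLaw, histLaw, hr, hρm, hπ m s s₀]
      field_simp
  obtain ⟨r, hr0, hr⟩ := key n le_rfl
  refine ⟨fun x a => r (fun i => x i.castSucc) a, fun x a => hr0 _ _, fun s x a => ?_⟩
  rw [histLaw, histLaw, hr]
  ring

/-- While the window is still the whole history, the posterior is that of the executed policy, and
it gives weight to wrong states only as far as the majority of the decoded observations may err. -/
theorem histExp_wrongWeight_le_two_mul [∀ h, Nonempty (A h)] (P : POMDP S X A) {L : ℕ}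
    (π : LStepPolicy X A L) {t : ℕ} (ht : t < L)
    (B : (∀ i : Fin (t + 1), X i) → (∀ i : Fin t, A i) → S t → Prop)
    [∀ x a, DecidablePred (B x a)]
    (hB : ∀ x a s s', ¬ B x a s → ¬ B x a s' → s = s') :
    P.histExp (LStepPolicy.toPolicy π) t (P.wrongWeight (rollIn π t) L t) ≤
      2 * P.histExp (LStepPolicy.toPolicy π) t fun h =>
        if B h.2.1 h.2.2 (h.1 (Fin.last t)) then 1 else 0 := by
  classical
  obtain ⟨r, hr0, hr⟩ := P.exists_histLaw_eq_mul (π := LStepPolicy.toPolicy π) (ρ := rollIn π t) t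
    (fun _ _ _ _ _ => rfl) (fun i _ => ⟨_, uniformDist_pos (A i), rollIn_of_le π (by omega)⟩)
  have hexp : ∀ g : (∀ i : Fin (t + 1), X i) → (∀ i : Fin t, A i) → S t → ℝ,
      P.histExp (LStepPolicy.toPolicy π) t (fun h => g h.2.1 h.2.2 (h.1 (Fin.last t))) =
        ∑ x, ∑ a, r x a * ∑ s, P.endWeight (rollIn π t) t x a s * g x a s := by
    intro g
    rw [histExp, Fintype.sum_prod_type, Finset.sum_comm, Fintype.sum_prod_type]
    refine Finset.sum_congr rfl fun x _ => Finset.sum_congr rfl fun a _ => ?_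
    simp only [hr, endWeight, Finset.sum_mul, ite_mul, zero_mul]
    rw [Finset.sum_comm]
    simp [Finset.mul_sum, mul_assoc]
  have hwrong : ∀ h : Hist S X A t, P.wrongWeight (rollIn π t) L t h =
      (fun x a s => ∑ s' ∈ Finset.univ.erase s, P.endWeight (rollIn π t) t x a s' /
        ∑ s', P.endWeight (rollIn π t) t x a s') h.2.1 h.2.2 (h.1 (Fin.last t)) := by
    intro h
    simp only [wrongWeight, windowWeight_eq_endWeight _ _ ht]
    congr!
  rw [P.histExp_congr _ t hwrong, hexp fun x a s => ∑ s' ∈ Finset.univ.erase s,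
      P.endWeight (rollIn π t) t x a s' / ∑ s', P.endWeight (rollIn π t) t x a s',
    hexp fun x a s => if B x a s then 1 else 0, Finset.mul_sum]
  refine Finset.sum_le_sum fun x _ => ?_
  rw [Finset.mul_sum]
  refine Finset.sum_le_sum fun a _ => ?_
  rw [mul_left_comm]
  refine mul_le_mul_of_nonneg_left (sum_mul_wrong_le _ (fun s => ?_) (B x a) (hB x a)) (hr0 x a)
  refine Finset.sum_nonneg fun ss _ => ?_
  split_ifs
  exacts [P.histLaw_nonneg _ _ _, le_rfl]

/-- Before the window is full, the expected weight of the wrong states decays exponentially in the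
number of observations, without a factor for the number of states. The Chernoff bound
`(2 √δ) ^ (t + 1)` is weakened to a multiple of `δ` that is summable over `t`. -/
theorem histExp_wrongWeight_le_of_lt [∀ h, Nonempty (A h)] {P : POMDP S X A} {δ : ℝ}
    (hB : P.IsPerturbedBlockMDP δ) (hδ : δ ≤ 1 / 16) (hD : P.DeterministicTransitions) {L : ℕ}
    (π : LStepPolicy X A L) {t : ℕ} (htL : t < L) (ht : t < P.horizon) :
    P.histExp (LStepPolicy.toPolicy π) t (P.wrongWeight (rollIn π t) L t) ≤
      16 * δ * (1 / 2) ^ t := by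
  classical
  have hδ0 := hB.1
  obtain ⟨D, hDinj, hDerr⟩ := hB.exists_decoder
  set N := fun n => matchCount (fun n s a s' => P.trans n s a s' = 1) D n with hN
  have hsucc : ∀ n s a s' s'', P.trans n s a s' = 1 → P.trans n s a s'' = 1 → s' = s'' := by
    intro n s a s' s'' h h'
    by_contra hne
    have h1 := PDist.sum_eq_one (P.trans n s a)
    have h2 := Finset.add_le_sum (fun i _ => PDist.nonneg (P.trans n s a) i)
      (Finset.mem_univ s') (Finset.mem_univ s'') hne
    linarith
  have hsum := sum_matchCount_le (fun n s a s' => P.trans n s a s' = 1) D hsucc hDinj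
  -- A state is bad if at most half of the observations match it. Two states cannot both be good.
  refine (P.histExp_wrongWeight_le_two_mul π htL (fun x a s => 2 * N t x a s ≤ t + 1) ?_).trans ?_
  · intro x a s s' hs hs'
    by_contra hne
    have h1 := hsum t x a
    have h2 := Finset.add_le_sum (fun i _ => Nat.zero_le (N t x a i))
      (Finset.mem_univ s) (Finset.mem_univ s') hne
    simp only [hN] at h2 hs hs'
    omega
  rcases Nat.eq_zero_or_pos t with rfl | htpos
  · have : P.histExp (LStepPolicy.toPolicy π) 0 (fun h => if 2 * N 0 h.2.1 h.2.2
        (h.1 (Fin.last 0)) ≤ 0 + 1 then 1 else 0) ≤ δ := by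
      rw [histExp_zero]
      calc _ ≤ ∑ s, P.init s * δ := by
            refine Finset.sum_le_sum fun s _ => mul_le_mul_of_nonneg_left ?_ (PDist.nonneg _ _)
            refine le_trans (Finset.sum_le_sum fun x _ => mul_le_mul_of_nonneg_left ?_
              (PDist.nonneg _ _)) (hDerr 0 ht s)
            simp only [hN, matchCount, histZeroEquiv, Equiv.coe_fn_mk, extend_last, extend_zero]
            by_cases hDs : D 0 s x <;> simp [hDs]
        _ = δ := by rw [← Finset.sum_mul, PDist.sum_eq_one, one_mul]
    simp only [pow_zero, mul_one]
    linarith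
  · set q := √δ with hq
    have hq2 : q ^ 2 = δ := Real.sq_sqrt hδ0.le
    have hq0 : 0 < q := Real.sqrt_pos.2 hδ0
    have hq1 : q ≤ 1 / 4 := by
      rw [hq, Real.sqrt_le_left (by norm_num)]
      linarith
    -- Markov's inequality: on bad states, `δ ^ N` is at least `√δ ^ (t + 1)`.
    have hmoment := histExp_pow_matchCount_le hδ0 (by linarith) hD D hDerr
      (LStepPolicy.toPolicy π) t ht
    have hmarkov : q ^ (t + 1) * P.histExp (LStepPolicy.toPolicy π) t (fun h =>
        if 2 * N t h.2.1 h.2.2 (h.1 (Fin.last t)) ≤ t + 1 then 1 else 0) ≤ (2 * δ) ^ (t + 1) := by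
      rw [← histExp_const_mul]
      refine (P.histExp_mono _ t fun h _ => ?_).trans hmoment
      split_ifs with hbad
      · rw [mul_one, ← hq2, ← pow_mul]
        exact pow_le_pow_of_le_one hq0.le (by linarith) hbad
      · rw [mul_zero]
        positivity
    have hprob : P.histExp (LStepPolicy.toPolicy π) t (fun h =>
        if 2 * N t h.2.1 h.2.2 (h.1 (Fin.last t)) ≤ t + 1 then 1 else 0) ≤ (2 * q) ^ (t + 1) := by
      refine le_of_mul_le_mul_left (hmarkov.trans_eq ?_) (pow_pos hq0 (t + 1))
      rw [← mul_pow, ← hq2]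
      ring
    obtain ⟨m, rfl⟩ : ∃ m, t = m + 1 := ⟨t - 1, by omega⟩
    calc _ ≤ 2 * (2 * q) ^ (m + 1 + 1) := mul_le_mul_of_nonneg_left hprob (by norm_num)
      _ = 8 * δ * (2 * q) ^ m := by rw [← hq2]; ring
      _ ≤ 8 * δ * (1 / 2) ^ m := by
          refine mul_le_mul_of_nonneg_left (pow_le_pow_left₀ (by positivity) (by linarith) m)
            (by positivity)
      _ = _ := by ring

/-- The bound for small `δ`, summed over the steps. -/
theorem IsForwardOutput.tvDist_trajLaw_le_of_le [∀ h, Nonempty (A h)] {P : POMDP S X A} {δ : ℝ}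
    {πlat : LatentPolicy S A} {L : ℕ} {π : LStepPolicy X A L} (hπ : P.IsForwardOutput πlat π)
    (hB : P.IsPerturbedBlockMDP δ) (hδ : δ ≤ 1 / 16) (hD : P.DeterministicTransitions) :
    tvDist (P.trajLaw (LatentPolicy.toPolicy πlat)) (P.trajLaw (LStepPolicy.toPolicy π)) ≤
      32 * δ + (2 * √δ) ^ L * P.maxStates * P.horizon := by
  have hδ0 := hB.1
  refine hπ.tvDist_trajLaw_le.trans ?_
  calc _ ≤ ∑ t ∈ Finset.range P.horizon, (16 * δ * (1 / 2) ^ t + (2 * √δ) ^ L * P.maxStates) := by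
        refine Finset.sum_le_sum fun t ht => ?_
        rw [Finset.mem_range] at ht
        rcases lt_or_ge t L with htL | htL
        · exact (histExp_wrongWeight_le_of_lt hB hδ hD π htL ht).trans
            (le_add_of_nonneg_right (by positivity))
        · obtain ⟨T, rfl⟩ := Nat.exists_eq_add_of_le' htL
          refine (histExp_wrongWeight_le_of_le hB hD π ht).trans
            (le_add_of_nonneg_of_le (by positivity) ?_)
          refine mul_le_mul_of_nonneg_left (Nat.cast_le.2 ?_) (by positivity)
          exact Finset.le_sup (f := fun h => Fintype.card (S h))
            (Finset.mem_range.2 (by omega : T < P.horizon))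
    _ ≤ _ := by
        rw [Finset.sum_add_distrib, ← Finset.mul_sum, Finset.sum_const, Finset.card_range,
          nsmul_eq_mul, mul_comm (P.horizon : ℝ)]
        have := sum_geometric_two_le P.horizon
        have h2 := mul_le_mul_of_nonneg_left this (by positivity : 0 ≤ 16 * δ)
        linarith

end POMDP

end

theorem mainTheorem3 :
    ∃ C₁ C : ℝ, 0 < C₁ ∧ 1 < C ∧
      ∀ (S X A : ℕ → Type*)
        [∀ h, Fintype (S h)] [∀ h, Fintype (X h)] [∀ h, Fintype (A h)] [∀ h, Nonempty (A h)]
        (P : POMDP S X A) (δ : ℝ) (L : ℕ) (πlat : LatentPolicy S A) (πfwd : LStepPolicy X A L),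
        P.RewardsAtMostOne →
        P.IsPerturbedBlockMDP δ →
        P.DeterministicTransitions →
        P.IsForwardOutput πlat πfwd →
        (P.value (LatentPolicy.toPolicy πlat) - P.value (LStepPolicy.toPolicy πfwd)
            ≤ tvDist (P.latentLaw (LatentPolicy.toPolicy πlat))
                (P.latentLaw (LStepPolicy.toPolicy πfwd)) ∧
          tvDist (P.latentLaw (LatentPolicy.toPolicy πlat))
              (P.latentLaw (LStepPolicy.toPolicy πfwd))
            ≤ tvDist (P.trajLaw (LatentPolicy.toPolicy πlat))
                (P.trajLaw (LStepPolicy.toPolicy πfwd)) ∧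
          tvDist (P.trajLaw (LatentPolicy.toPolicy πlat))
              (P.trajLaw (LStepPolicy.toPolicy πfwd))
            ≤ C₁ * δ + (C * δ) ^ ((L : ℝ) / 9) * P.maxStates * P.horizon) ∧
        (P.IsOptimalLatent πlat →
          ∀ πstar : LStepPolicy X A P.horizon, P.IsOptimalExecutable πstar →
            P.value (LStepPolicy.toPolicy πstar) - P.value (LStepPolicy.toPolicy πfwd)
              ≤ P.value (LatentPolicy.toPolicy πlat) - P.value (LStepPolicy.toPolicy πfwd)) := by
  refine ⟨32, 4, by norm_num, by norm_num, ?_⟩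
  intro S X A _ _ _ _ P δ L πlat πfwd hR hB hD hF
  have hδ0 := hB.1
  refine ⟨⟨P.value_sub_value_le_tvDist hR _ _, P.tvDist_latentLaw_le _ _, ?_⟩,
    fun hlat πstar _ => sub_le_sub_right (hlat.value_le _) _⟩
  rcases le_or_gt δ (1 / 16) with hδ | hδ
  · refine (hF.tvDist_trajLaw_le_of_le hB hδ hD).trans ?_
    -- The exponent obtained is `L / 2`, and `L / 9` is weaker because `4 * δ ≤ 1`.
    have hpow : (2 * √δ) ^ L ≤ (4 * δ) ^ ((L : ℝ) / 9) := by
      have h4 : 2 * √δ = (4 * δ) ^ (1 / 2 : ℝ) := by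
        rw [← Real.sqrt_eq_rpow, Real.sqrt_mul (by norm_num), show (4 : ℝ) = 2 ^ 2 by norm_num,
          Real.sqrt_sq (by norm_num)]
      rw [h4, ← Real.rpow_natCast, ← Real.rpow_mul (by positivity)]
      refine Real.rpow_le_rpow_of_exponent_ge (by positivity) (by linarith) ?_
      have : (0 : ℝ) ≤ L := Nat.cast_nonneg L
      linarith
    gcongr
  · -- Here the right-hand side exceeds `1`.
    refine (P.tvDist_trajLaw_le_one _ _).trans ?_
    have : 0 ≤ (4 * δ) ^ ((L : ℝ) / 9) * P.maxStates * P.horizon := by positivity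
    linarith
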